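/- Let $G\subset \mathrm O(n)$ be a compact group acting on $\mathbb R^n$, with Lie algebra $\mathfrak g=\{A\in\mathbb R^{n\times n}:\exp(tA)\in G\ \forall t\in\mathbb R\}$, and let $G_z$ denote the isotropy group of a point $z$. For a $G$-invariant set $M$ in $\mathbb R^n$ or in $\mathbb R^n\times\mathbb R^n$ (with the action $k(x,\xi)=(kx,k\xi)$), the principal stratum of $M$ is the set of those $z\in M$ whose orbit is of maximal type in $M$, i.e. such that $G_z$ is conjugate in $G$ to a subgroup of $G_w$ for every $w\in M$. Let $\kappa$ be the dimension of the principal orbits of $G$ in $\mathbb R^n$, and let $\operatorname{Sing}\mathbb R^n$ be the complement of the principal stratum of $\mathbb R^n$. Put $$\Omega_0=\{(x,\xi)\in\mathbb R^n\times\mathbb R^n:\langle Ax,\xi\rangle=0\ \text{ for all }A\in\mathfrak g\},$$ let $\operatorname{Reg}\Omega_0$ be the principal stratum of $\Omega_0$, and let $$\operatorname{Reg}\mathcal C=\{(x,\xi,k):(x,\xi)\in\operatorname{Reg}\Omega_0,\ k\in G,\ kx=x,\ k\xi=\xi\}.$$ Assume that $\operatorname{Sing}\mathbb R^n$ is contained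 in a linear subspace $F\subset\mathbb R^n$ of dimension $r<n$, and let $R_0\in\mathrm O(n)$ satisfy $R_0(\mathbb R^r\times\{0\})=F$. Consider the phase function (the weak transform of $\langle x-kx,\xi\rangle$ in the chart $\xi=R_0\,\eta_n(\eta',1)$ of the blow-up along $\xi=0$) $$\psi_{wk}:\mathbb R^n\times\mathbb R^{n-1}\times G\to\mathbb R,\qquad \psi_{wk}(x,\eta',k)=\langle(\mathbf 1-k)R_0x,\,R_0(\eta',1)\rangle .$$ Then the critical set $\mathcal C_{\psi_{wk}}=\{\psi_{wk}'=0\}$ is $$\mathcal C_{\psi_{wk}}=\{(x,\eta',k)\in\mathbb R^n\times\mathbb R^{n-1}\times G:(R_0x,R_0(\eta',1),k)\in\operatorname{Reg}\mathcal C\}.$$ It is a smooth submanifold of $\mathbb R^n\times\mathbb R^{n-1}\times G$ of codimension $2\kappa$. Moreover, at each point $(x,\eta',k)$ of $\mathcal C_{\psi_{wk}}$ the Hessian of $\psi_{wk}$ restricts to a non-degenerate quadratic form on the normal space of $\mathcal C_{\psi_{wk}}$ in $\mathbb R^n\times\mathbb R^{n-1}\times G$, taken with respect to any Riemannian metric.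 -/

import Mathlib

open scoped RealInnerProductSpace

noncomputable section

namespace WeakPhase

/-- The orthogonal group `O(V)` of a Euclidean space `V` (below: `V = ℝⁿ`): the linear maps `k`
with `k* k = k k* = 1`, where `k*` is the adjoint (transpose). It carries the topology induced by
the operator norm and is compact, so its closed subgroups are exactly its compact subgroups. -/
abbrev OrthGroup (V : Type*) [NormedAddCommGroup V] [InnerProductSpace ℝ V]
    [FiniteDimensional ℝ V] := unitary (V →L[ℝ] V)

section LieAlgebra

variable {V : Type*} [NormedAddCommGroup V] [InnerProductSpace ℝ V] [FiniteDimensional ℝ V]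

/-- The linear maps `A` all of whose multiples exponentiate into `G`. -/
def lieCarrier (G : ClosedSubgroup (OrthGroup V)) : Set (V →L[ℝ] V) :=
  {A | ∀ t : ℝ, ∃ k : OrthGroup V, k ∈ G ∧ (k : V →L[ℝ] V) = NormedSpace.exp (t • A)}

theorem norm_pow_sub_pow_le {R : Type*} [NormedRing R] {x y : R} {K : ℝ} {m : ℕ}
    (hx : ∀ z : R, ‖x * z‖ ≤ ‖z‖) (hy : ∀ j ≤ m, ‖y ^ j‖ ≤ K) :
    ∀ j ≤ m, ‖x ^ j - y ^ j‖ ≤ j * (‖x - y‖ * K) := by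
  intro j
  induction j with
  | zero => intro _; simp
  | succ j ih =>
    intro hj
    have h1 : x ^ (j + 1) - y ^ (j + 1) = x * (x ^ j - y ^ j) + (x - y) * y ^ j := by
      rw [pow_succ', pow_succ']; noncomm_ring
    rw [h1]
    calc ‖x * (x ^ j - y ^ j) + (x - y) * y ^ j‖
        ≤ ‖x * (x ^ j - y ^ j)‖ + ‖(x - y) * y ^ j‖ := norm_add_le _ _
      _ ≤ j * (‖x - y‖ * K) + ‖x - y‖ * K := by
          refine add_le_add ((hx _).trans (ih (by omega))) ((norm_mul_le _ _).trans ?_)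
          exact mul_le_mul_of_nonneg_left (hy j (by omega)) (norm_nonneg _)
      _ = ((j + 1 : ℕ) : ℝ) * (‖x - y‖ * K) := by push_cast; ring

theorem isClosed_image (G : ClosedSubgroup (OrthGroup V)) :
    IsClosed ((fun k : OrthGroup V => (k : V →L[ℝ] V)) '' (G : Set (OrthGroup V))) := by
  have hU : IsClosed ((unitary (V →L[ℝ] V) : Set (V →L[ℝ] V))) := by
    have : ContinuousStar (V →L[ℝ] V) := ⟨ContinuousLinearMap.adjoint.continuous⟩
    exact isClosed_unitary
  exact hU.isClosedEmbedding_subtypeVal.isClosedMap _ G.isClosed'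

theorem norm_unitary_mul_le (k : OrthGroup V) (z : V →L[ℝ] V) :
    ‖(k : V →L[ℝ] V) * z‖ ≤ ‖z‖ := by
  have := CStarRing.norm_coe_unitary_mul k z
  exact this.le

theorem lieCarrier_add (G : ClosedSubgroup (OrthGroup V)) {A B : V →L[ℝ] V}
    (hA : A ∈ lieCarrier G) (hB : B ∈ lieCarrier G) : A + B ∈ lieCarrier G := by
  let _ : NormedAlgebra ℚ (V →L[ℝ] V) := NormedAlgebra.restrictScalars ℚ ℝ _
  intro t
  set C := A + B with hC
  let f : ℝ → (V →L[ℝ] V) := fun s =>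
    NormedSpace.exp (s • A) * NormedSpace.exp (s • B) - NormedSpace.exp (s • C)
  have hexp : ∀ D : V →L[ℝ] V, HasDerivAt (fun s : ℝ => NormedSpace.exp (s • D)) D 0 := by
    intro D
    have := hasDerivAt_exp_smul_const (𝕂 := ℝ) D (0 : ℝ)
    rwa [zero_smul ℝ D, NormedSpace.exp_zero, one_mul] at this
  have hf : HasDerivAt f 0 0 := by
    have := ((hexp A).mul (hexp B)).sub (hexp C)
    rwa [zero_smul ℝ A, zero_smul ℝ B, NormedSpace.exp_zero, one_mul, mul_one, hC, sub_self] at this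
  have hcont : Continuous fun s : ℝ => ‖NormedSpace.exp (s • (t • C))‖ :=
    (NormedSpace.exp_continuous.comp (continuous_id.smul continuous_const)).norm
  obtain ⟨K, hK⟩ := (isCompact_Icc (a := (0 : ℝ)) (b := 1)).bddAbove_image hcont.continuousOn
  have hK' : ∀ s ∈ Set.Icc (0 : ℝ) 1, ‖NormedSpace.exp (s • (t • C))‖ ≤ K := fun s hs =>
    hK ⟨s, hs, rfl⟩
  let x : ℕ → (V →L[ℝ] V) := fun m =>
    NormedSpace.exp ((t / (m + 1 : ℕ)) • A) * NormedSpace.exp ((t / (m + 1 : ℕ)) • B)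
  let y : ℕ → (V →L[ℝ] V) := fun m => NormedSpace.exp ((t / (m + 1 : ℕ)) • C)
  have hxG : ∀ m, ∃ k : OrthGroup V, k ∈ G ∧ (k : V →L[ℝ] V) = x m := by
    intro m
    obtain ⟨k, hk, hk'⟩ := hA (t / (m + 1 : ℕ))
    obtain ⟨l, hl, hl'⟩ := hB (t / (m + 1 : ℕ))
    exact ⟨k * l, mul_mem hk hl, by simp only [Submonoid.coe_mul, hk', hl', x]⟩
  have hypow : ∀ m j : ℕ,
      y m ^ j = NormedSpace.exp (((j : ℝ) / (m + 1 : ℕ)) • (t • C)) := by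
    intro m j
    simp only [y]
    rw [← NormedSpace.exp_nsmul, ← Nat.cast_smul_eq_nsmul ℝ, smul_smul, smul_smul]
    congr 2
    ring
  have hym : ∀ m, y m ^ (m + 1) = NormedSpace.exp (t • C) := by
    intro m
    rw [hypow, div_self (by positivity), one_smul]
  have hbound : ∀ m : ℕ, ‖x m ^ (m + 1) - NormedSpace.exp (t • C)‖
      ≤ ((m + 1 : ℕ) : ℝ) * (‖x m - y m‖ * K) := by
    intro m
    rw [← hym m]
    refine norm_pow_sub_pow_le (m := m + 1) ?_ ?_ _ le_rfl
    · intro z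
      obtain ⟨k, -, hk⟩ := hxG m
      rw [← hk]
      exact norm_unitary_mul_le k z
    · intro j hj
      rw [hypow]
      refine hK' _ ⟨by positivity, ?_⟩
      rw [div_le_one (by positivity)]
      exact_mod_cast hj
  have hlim0 : Filter.Tendsto (fun m : ℕ => ((m + 1 : ℕ) : ℝ) * ‖x m - y m‖) Filter.atTop
      (nhds 0) := by
    have hn : Filter.Tendsto (fun m : ℕ => ‖((m + 1 : ℕ) : ℝ)‖) Filter.atTop Filter.atTop := by
      have : Filter.Tendsto (fun m : ℕ => ((m + 1 : ℕ) : ℝ)) Filter.atTop Filter.atTop :=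
        tendsto_natCast_atTop_atTop.comp (Filter.tendsto_add_atTop_nat 1)
      exact tendsto_norm_atTop_atTop.comp this
    have h := (hf.hasFDerivAt.lim t hn).norm
    have hf0 : f 0 = 0 := by
      simp only [f]
      rw [zero_smul ℝ A, zero_smul ℝ B, zero_smul ℝ C, NormedSpace.exp_zero, one_mul, sub_self]
    have hr : ∀ m : ℕ, (((m + 1 : ℕ) : ℝ))⁻¹ • t = t / ((m + 1 : ℕ) : ℝ) := fun m => by
      rw [smul_eq_mul]; ring
    simp only [hr, zero_add, hf0, sub_zero, norm_smul, Real.norm_natCast] at h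
    simpa [f, x, y] using h
  have hlim : Filter.Tendsto (fun m : ℕ => x m ^ (m + 1)) Filter.atTop
      (nhds (NormedSpace.exp (t • C))) := by
    rw [tendsto_iff_norm_sub_tendsto_zero]
    refine squeeze_zero (fun _ => norm_nonneg _) hbound ?_
    have := hlim0.mul_const K
    simpa only [mul_assoc, zero_mul] using this
  have hmem := (isClosed_image G).mem_of_tendsto hlim (Filter.Eventually.of_forall fun m => by
    obtain ⟨k, hk, hk'⟩ := hxG m
    exact ⟨k ^ (m + 1), pow_mem hk _, by simp [← hk']⟩)
  obtain ⟨k, hk, hk'⟩ := hmem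
  exact ⟨k, hk, hk'⟩

/-- The Lie algebra `𝔤 = {A | exp (t A) ∈ G for all t}` of a compact group `G ⊆ O(V)`. -/
def lieAlg (G : ClosedSubgroup (OrthGroup V)) : Submodule ℝ (V →L[ℝ] V) where
  carrier := lieCarrier G
  zero_mem' := fun t => ⟨1, one_mem G, by simp⟩
  add_mem' := lieCarrier_add G
  smul_mem' := fun c A hA t => by
    obtain ⟨k, hk, hk'⟩ := hA (t * c)
    exact ⟨k, hk, by rw [hk', smul_smul]⟩

theorem exists_exp (G : ClosedSubgroup (OrthGroup V)) (A : lieAlg G) :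
    ∃ k : G.toSubgroup, ((k : OrthGroup V) : V →L[ℝ] V)
      = NormedSpace.exp (A : V →L[ℝ] V) := by
  obtain ⟨k, hk, hk'⟩ := A.2 1
  exact ⟨⟨k, hk⟩, by simpa using hk'⟩

/-- The exponential map `𝔤 → G`. -/
def expG (G : ClosedSubgroup (OrthGroup V)) (A : lieAlg G) : G.toSubgroup :=
  ⟨⟨NormedSpace.exp (A : V →L[ℝ] V), by
      obtain ⟨k, hk⟩ := exists_exp G A
      rw [← hk]; exact k.1.2⟩, by
      obtain ⟨k, hk⟩ := exists_exp G A
      convert k.2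
      exact hk.symm⟩

end LieAlgebra

section OrbitTypes

variable {V : Type*} [NormedAddCommGroup V] [InnerProductSpace ℝ V] [FiniteDimensional ℝ V]

/-- The action of `G ⊆ O(V)` on `V` is the evaluation of linear maps. -/
theorem smul_euc (G : ClosedSubgroup (OrthGroup V)) (k : G.toSubgroup) (x : V) :
    k • x = ((k : OrthGroup V) : V →L[ℝ] V) x := rfl

/-- The action of `G ⊆ O(V)` on `V × V` is the diagonal one. -/
theorem smul_euc_prod (G : ClosedSubgroup (OrthGroup V)) (k : G.toSubgroup)
    (z : V × V) :
    k • z = (((k : OrthGroup V) : V →L[ℝ] V) z.1,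
      ((k : OrthGroup V) : V →L[ℝ] V) z.2) := rfl

/-- `H` is an isotropy group of a point of `M` which is conjugate to a subgroup of every isotropy
group of a point of `M`; that is, `G/H` is the maximum orbit type on the invariant set `M`. -/
def IsPrincipalIsotropy {G X : Type*} [Group G] [MulAction G X] (M : Set X) (H : Subgroup G) :
    Prop :=
  (∃ z ∈ M, MulAction.stabilizer G z = H) ∧
    ∀ w ∈ M, ∃ g : G, ∀ k ∈ H, g * k * g⁻¹ ∈ MulAction.stabilizer G w

/-- The principal stratum of `M`: the union of the orbits of principal type. -/
def principalStratum (G : Type*) {X : Type*} [Group G] [MulAction G X] (M : Set X) : Set X :=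
  {z ∈ M | IsPrincipalIsotropy M (MulAction.stabilizer G z)}

/-- The dimension of the orbit `G x`, whose tangent space at `x` is `𝔤 x = {A x | A ∈ 𝔤}`. -/
def orbitDim (G : ClosedSubgroup (OrthGroup V)) (x : V) : ℕ :=
  Module.finrank ℝ
    ((lieAlg G).map ((ContinuousLinearMap.apply ℝ (V) x : _ →L[ℝ] V) : _ →ₗ[ℝ] V))

/-- The set of points of `V` on principal orbits. -/
def regSet (G : ClosedSubgroup (OrthGroup V)) : Set V :=
  principalStratum G.toSubgroup (Set.univ : Set V)

/-- The set of points of `V` on non-principal orbits. -/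
def singSet (G : ClosedSubgroup (OrthGroup V)) : Set V :=
  (regSet G)ᶜ

/-- The zero level `Ω₀` of the momentum map: `⟨A x, ξ⟩ = 0` for all `A ∈ 𝔤`. -/
def Omega (G : ClosedSubgroup (OrthGroup V)) : Set (V × V) :=
  {z | ∀ A ∈ lieAlg G, ⟪A z.1, z.2⟫ = 0}

/-- `Reg Ω₀`, the principal stratum of `Ω₀` for the diagonal action `k (x, ξ) = (k x, k ξ)`. -/
def regOmega (G : ClosedSubgroup (OrthGroup V)) : Set (V × V) :=
  principalStratum G.toSubgroup (Omega G)

/-- `Reg 𝒞 = {(z, k) | z ∈ Reg Ω₀, k z = z}`, written as a set of triples `(x, ξ, k)`. -/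
def regC (G : ClosedSubgroup (OrthGroup V)) : Set (V × V × G.toSubgroup) :=
  {p | (p.1, p.2.1) ∈ regOmega G ∧ p.2.2 ∈ MulAction.stabilizer G.toSubgroup (p.1, p.2.1)}

end OrbitTypes

section Manifold

variable {V W : Type*} [NormedAddCommGroup V] [InnerProductSpace ℝ V] [FiniteDimensional ℝ V]
  [NormedAddCommGroup W] [InnerProductSpace ℝ W] [FiniteDimensional ℝ W]

variable (W) in
/-- The manifold `V × W × G` (below: `V = ℝⁿ` and `W = ℝⁿ⁻¹`). -/
abbrev PhaseSpace (G : ClosedSubgroup (OrthGroup V)) := V × W × G.toSubgroup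

variable (W) in
/-- The model space `V × W × 𝔤` of `V × W × G`. It is identified with the tangent space at
`(x, η', k)` by letting `(q, p', A)` stand for the tangent vector `(q, p', A k)`. -/
abbrev ModelSpace (G : ClosedSubgroup (OrthGroup V)) := V × W × lieAlg G

variable (G : ClosedSubgroup (OrthGroup V))

/-- The exponential coordinates `(q, p', A) ↦ (x + q, η' + p', exp(A) k)` of `V × W × G` centred at
`(x, η', k)`. They restrict to a smooth chart near `0`, and their differential at `0` is the
identification of the tangent space at `(x, η', k)` with the model space. -/
def expChart (p : PhaseSpace W G) (w : ModelSpace W G) : PhaseSpace W G :=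
  (p.1 + w.1, p.2.1 + w.2.1, expG G w.2.2 * p.2.2)

/-- The set of critical points of a smooth function on `V × W × G`: the points where its
differential, computed in the exponential coordinates centred at the point, vanishes. -/
def critSet (φ : PhaseSpace W G → ℝ) : Set (PhaseSpace W G) :=
  {p | fderiv ℝ (fun w : ModelSpace W G => φ (expChart G p w)) 0 = 0}

/-- The Hessian of a smooth function on `V × W × G` at a critical point `p`, as a bilinear form on
the tangent space at `p`: the second derivative at `0` in the exponential coordinates centred at
`p`. -/
def hess (φ : PhaseSpace W G → ℝ) (p : PhaseSpace W G) :
    LinearMap.BilinForm ℝ (ModelSpace W G) :=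
  (fderiv ℝ (fderiv ℝ (fun w : ModelSpace W G => φ (expChart G p w))) 0).toLinearMap₁₂

/-- `S` is an (embedded) smooth submanifold of `V × W × G` of codimension `c`: in the exponential
coordinates around each of its points, `S` is near the point the zero set of a smooth `ℝᶜ`-valued
map whose differential is onto on that zero set. -/
def IsSmoothSubmanifold (S : Set (PhaseSpace W G)) (c : ℕ) : Prop :=
  ∀ p ∈ S, ∃ (U : Set (ModelSpace W G)) (f : ModelSpace W G → EuclideanSpace ℝ (Fin c)),
    IsOpen U ∧ (0 : ModelSpace W G) ∈ U ∧ ContDiffOn ℝ ((⊤ : ℕ∞) : WithTop ℕ∞) f U ∧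
    (∀ w ∈ U, expChart G p w ∈ S ↔ f w = 0) ∧
    (∀ w ∈ U, f w = 0 → Function.Surjective (fderiv ℝ f w))

/-- The tangent vectors at `p` of a submanifold `S`, as vectors of the model space: the velocities
at `p` of the curves in `S` through `p`. -/
def tangentVectors (S : Set (PhaseSpace W G)) (p : PhaseSpace W G) : Set (ModelSpace W G) :=
  {v | ∃ γ : ℝ → ModelSpace W G, γ 0 = 0 ∧ HasDerivAt γ v 0 ∧ ∀ t, expChart G p (γ t) ∈ S}

/-- The normal space at `p` of a submanifold `S` with respect to an inner product `b` on the
tangent space of `V × W × G` at `p`: the vectors orthogonal to all tangent vectors of `S`. -/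
def normalSpace (S : Set (PhaseSpace W G)) (p : PhaseSpace W G)
    (b : LinearMap.BilinForm ℝ (ModelSpace W G)) : Submodule ℝ (ModelSpace W G) where
  carrier := {v | ∀ u ∈ tangentVectors G S p, b u v = 0}
  zero_mem' := fun _ _ => map_zero _
  add_mem' := fun ha hb u hu => by rw [map_add, ha u hu, hb u hu, add_zero]
  smul_mem' := fun c a ha u hu => by rw [map_smul, ha u hu, smul_zero]

end Manifold

section Phase

/-- Euclidean space `ℝⁿ`. -/
abbrev Euc (n : ℕ) := EuclideanSpace ℝ (Fin n)

/-- The vector `(η', 1)` of `ℝⁿ`, where `n = m + 1`. -/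
def appendOne {m : ℕ} (e : Euc m) : Euc (m + 1) :=
  WithLp.toLp 2 (Fin.snoc (α := fun _ => ℝ) (fun i => e i) 1)

/-- The subspace `ℝʳ × {0}` of `ℝⁿ`. -/
def coordSubspace (n r : ℕ) : Submodule ℝ (Euc n) where
  carrier := {y | ∀ i : Fin n, r ≤ (i : ℕ) → y i = 0}
  zero_mem' := fun _ _ => rfl
  add_mem' := fun ha hb i hi => by simp [ha i hi, hb i hi]
  smul_mem' := fun c a ha i hi => by simp [ha i hi]

/-- The phase function `ψ(x, η', k) = ⟨(1 - k) R₀ x, R₀ (η', 1)⟩` on `ℝⁿ × ℝⁿ⁻¹ × G`. -/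
def psiWk {m : ℕ} (G : ClosedSubgroup (OrthGroup (Euc (m + 1))))
    (R₀ : Euc (m + 1) ≃ₗᵢ[ℝ] Euc (m + 1)) (p : PhaseSpace (Euc m) G) : ℝ :=
  ⟪R₀ p.1 - ((p.2.2 : OrthGroup (Euc (m + 1))) : Euc (m + 1) →L[ℝ] Euc (m + 1)) (R₀ p.1),
    R₀ (appendOne p.2.1)⟫

end Phase

end WeakPhase

end

open scoped RealInnerProductSpace

noncomputable section

namespace WeakPhase

open Filter Topology

/-! ### The isometric action of `G` and the adjoint action on its Lie algebra. -/

section GroupAction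

variable {V : Type*} [NormedAddCommGroup V] [InnerProductSpace ℝ V] [FiniteDimensional ℝ V]
  {G : ClosedSubgroup (OrthGroup V)}

/-! Write `ζ = R₀(η', 1)` and replace `R₀ x` by `x`. The last coordinate of `(η', 1)` is `1`,
whereas it vanishes on `ℝʳ × {0}` because `r < n`. So `ζ` avoids `F` and always lies on a principal
orbit; everything rests on this.

Critical points. The derivative in `x` gives `kζ = ζ`. The derivative in `η'` makes `(1 - k)x`
orthogonal to the directions of the hyperplane of the `ζ`; it is also orthogonal to `ζ`, which is
fixed by `k`, so `kx = x`. The derivative in `k` gives `(x, ζ) ∈ Ω₀`. A point of `Ω₀` with principal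
`ζ` is in `Reg Ω₀`, since the isotropy group of `ζ` is conjugate into that of every `w ∈ Ω₀`
(`exists_conj_of_mem_Omega`). This is proved by letting points `y + tν` on a normal line tend to
`y`: conjugates of a fixed isotropy element fix these points, and their limit fixes both `y` and
`ν`.

Submanifold. Two facts about principal orbits, which stand in for a slice theorem, cut the equations
down to `2κ`. Nearby points of one orbit coincide if their difference is normal
(`IsOrbitFrame.eventually_eq_of_frameProj_eq_zero`), so only the tangential part of `kζ = ζ` is
needed. The isotropy group acts trivially on the normal space (`smul_eq_of_normal`), so `kx = x`
follows from `kζ = ζ` and `(x, ζ) ∈ Ω₀`. What remains are `κ` momentum equations and `κ` tangential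
ones, with surjective differential.

Hessian. Its kernel is the solution space of the linearized equations `kx = x`, `kζ = ζ`, `(x, ζ) ∈
Ω₀`. Velocities of curves in the critical set solve them, and the implicit function theorem gives a
curve for each solution. So the kernel is the tangent space, and a symmetric form is nondegenerate
on a complement of its kernel. -/

theorem norm_smul_eq (k : G.toSubgroup) (x : V) : ‖k • x‖ = ‖x‖ :=
  ContinuousLinearMap.norm_map_of_mem_unitary k.1.2 x

theorem inner_smul_smul (k : G.toSubgroup) (x y : V) : ⟪k • x, k • y⟫ = ⟪x, y⟫ :=
  ContinuousLinearMap.inner_map_map_of_mem_unitary k.1.2 x y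

theorem inner_smul_eq (k : G.toSubgroup) (x y : V) : ⟪k • x, y⟫ = ⟪x, k⁻¹ • y⟫ := by
  rw [← inner_smul_smul k x (k⁻¹ • y), smul_inv_smul]

theorem inner_smul_left_of_fixed {k : G.toSubgroup} {y : V} (hk : k • y = y) (x : V) :
    ⟪k • x, y⟫ = ⟪x, y⟫ := by
  conv_lhs => rw [← hk]
  exact inner_smul_smul k x y

instance compactSpace : CompactSpace G.toSubgroup := by
  have hemb : IsEmbedding (fun k : G.toSubgroup => (k.1.1 : V →L[ℝ] V)) :=
    IsEmbedding.subtypeVal.comp IsEmbedding.subtypeVal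
  rw [← isCompact_univ_iff, hemb.isCompact_iff, Set.image_univ]
  have hrange : Set.range (fun k : G.toSubgroup => (k.1.1 : V →L[ℝ] V))
      = (fun k : OrthGroup V => (k : V →L[ℝ] V)) '' (G : Set (OrthGroup V)) := by
    ext A
    constructor
    · rintro ⟨k, rfl⟩
      exact ⟨k.1, k.2, rfl⟩
    · rintro ⟨k, hk, rfl⟩
      exact ⟨⟨k, hk⟩, rfl⟩
  rw [hrange]
  refine Metric.isCompact_of_isClosed_isBounded (isClosed_image G) ?_
  refine (Metric.isBounded_iff_subset_closedBall 0).2 ⟨1, ?_⟩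
  rintro _ ⟨k, -, rfl⟩
  rw [mem_closedBall_zero_iff]
  refine ContinuousLinearMap.opNorm_le_bound _ zero_le_one fun x => ?_
  rw [one_mul]
  exact (ContinuousLinearMap.norm_map_of_mem_unitary k.2 x).le

instance continuousSMul : ContinuousSMul G.toSubgroup V :=
  ⟨((continuous_subtype_val.comp (continuous_subtype_val.comp continuous_fst)).clm_apply
    continuous_snd)⟩

theorem coe_mul_coe_inv (k : G.toSubgroup) : k.1.1 * (k⁻¹).1.1 = (1 : V →L[ℝ] V) := by
  have : k * k⁻¹ = 1 := mul_inv_cancel k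
  exact congrArg (fun l : G.toSubgroup => l.1.1) this

theorem exp_conj_unitary (k : G.toSubgroup) (A : V →L[ℝ] V) :
    NormedSpace.exp (k.1.1 * A * (k⁻¹).1.1) = k.1.1 * NormedSpace.exp A * (k⁻¹).1.1 := by
  let _ : NormedAlgebra ℚ (V →L[ℝ] V) := NormedAlgebra.restrictScalars ℚ ℝ _
  exact NormedSpace.exp_units_conj (Unitary.toUnits k.1) A

theorem conj_mem_lieAlg (k : G.toSubgroup) {A : V →L[ℝ] V} (hA : A ∈ lieAlg G) :
    k.1.1 * A * (k⁻¹).1.1 ∈ lieAlg G := by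
  intro t
  obtain ⟨l, hl, hl'⟩ := hA t
  refine ⟨k.1 * l * (k⁻¹).1, mul_mem (mul_mem k.2 hl) (k⁻¹).2, ?_⟩
  have : t • (k.1.1 * A * (k⁻¹).1.1) = k.1.1 * (t • A) * (k⁻¹).1.1 := by
    rw [mul_smul_comm, smul_mul_assoc]
  rw [this, exp_conj_unitary, ← hl']
  rfl

theorem expG_smul (A : lieAlg G) (x : V) :
    expG G A • x = NormedSpace.exp (A : V →L[ℝ] V) x := rfl

theorem hasDerivAt_exp_smul_apply (A : V →L[ℝ] V) (x : V) (t : ℝ) :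
    HasDerivAt (fun s : ℝ => NormedSpace.exp (s • A) x) (NormedSpace.exp (t • A) (A x)) t :=
  (ContinuousLinearMap.apply ℝ V x).hasFDerivAt.comp_hasDerivAt t
    (hasDerivAt_exp_smul_const (𝕂 := ℝ) A t)

theorem hasDerivAt_exp_smul_apply_zero (A : V →L[ℝ] V) (x : V) :
    HasDerivAt (fun s : ℝ => NormedSpace.exp (s • A) x) (A x) 0 := by
  have := hasDerivAt_exp_smul_apply A x 0
  rwa [zero_smul, NormedSpace.exp_zero] at this

/-- Differentiate the constant function `t ↦ ⟪exp(tA) x, exp(tA) y⟫` at `0`. -/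
theorem inner_apply_eq_neg {A : V →L[ℝ] V} (hA : A ∈ lieAlg G) (x y : V) :
    ⟪A x, y⟫ = -⟪x, A y⟫ := by
  have h1 := (hasDerivAt_exp_smul_apply_zero A x).inner ℝ (hasDerivAt_exp_smul_apply_zero A y)
  have h2 : (fun t : ℝ => ⟪NormedSpace.exp (t • A) x, NormedSpace.exp (t • A) y⟫)
      = fun _ => ⟪x, y⟫ := by
    funext t
    obtain ⟨k, -, hk⟩ := hA t
    rw [← hk]
    exact ContinuousLinearMap.inner_map_map_of_mem_unitary k.2 x y
  rw [h2] at h1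
  have h3 := h1.unique (hasDerivAt_const _ _)
  rw [zero_smul, NormedSpace.exp_zero] at h3
  simp only [one_apply_eq_self] at h3
  linarith

/-- The velocity of `exp(tA) B exp(-tA) x` at `t = 0` is `[A, B] x`. -/
theorem inner_commutator {A B : V →L[ℝ] V} (hA : A ∈ lieAlg G) (hB : B ∈ lieAlg G) {z : V × V}
    (hz : z ∈ Omega G) : ⟪A (B z.1), z.2⟫ = ⟪B (A z.1), z.2⟫ := by
  have h1 : HasDerivAt (fun t : ℝ => ⟪B (NormedSpace.exp (t • A) z.1),
      NormedSpace.exp (t • A) z.2⟫) (⟪B z.1, A z.2⟫ + ⟪B (A z.1), z.2⟫) 0 := by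
    have := (B.hasFDerivAt.comp_hasDerivAt 0 (hasDerivAt_exp_smul_apply_zero A z.1)).inner ℝ
      (hasDerivAt_exp_smul_apply_zero A z.2)
    simpa [zero_smul ℝ A, NormedSpace.exp_zero] using this
  -- Moving `exp(tA)` to the other side replaces `B` by a conjugate, which is again in `𝔤` and so
  -- pairs to zero at `z ∈ Ω₀`.
  have h2 : (fun t : ℝ => ⟪B (NormedSpace.exp (t • A) z.1), NormedSpace.exp (t • A) z.2⟫)
      = fun _ => 0 := by
    funext t
    obtain ⟨k, hk, hk'⟩ := hA t
    let l : G.toSubgroup := ⟨k, hk⟩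
    rw [← hk']
    have := hz _ (conj_mem_lieAlg l⁻¹ hB)
    rw [inv_inv] at this
    rw [← this]
    change ⟪B (l • z.1), l • z.2⟫ = ⟪l⁻¹ • B (l • z.1), z.2⟫
    rw [inner_smul_eq, inv_inv]
  rw [h2] at h1
  have h3 := h1.unique (hasDerivAt_const _ _)
  have h4 := inner_apply_eq_neg hA (B z.1) z.2
  linarith

end GroupAction

/-! ### The exponential map covers a neighbourhood of the identity of `G`. -/

section Logarithm

variable {V : Type*} [NormedAddCommGroup V] [InnerProductSpace ℝ V] [FiniteDimensional ℝ V]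

/-- `exp D v - v` is close to `D v`, relative to the size of `D v`, if `D` is small. -/
theorem exists_norm_exp_apply_sub_le {c : ℝ} (hc : 0 < c) :
    ∃ ε > 0, ∀ D : V →L[ℝ] V, ‖D‖ < ε → ∀ v : V,
      ‖NormedSpace.exp D v - v - D v‖ ≤ c * ‖D v‖ := by
  let _ : NormedAlgebra ℚ (V →L[ℝ] V) := NormedAlgebra.restrictScalars ℚ ℝ _
  have hcont : Tendsto (fun D : V →L[ℝ] V => NormedSpace.exp D) (𝓝 0) (𝓝 1) := by
    have := (NormedSpace.exp_continuous (𝔸 := V →L[ℝ] V)).tendsto 0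
    rwa [NormedSpace.exp_zero] at this
  obtain ⟨ε, hε, h⟩ := Metric.tendsto_nhds_nhds.1 hcont c hc
  refine ⟨ε, hε, fun D hD v => ?_⟩
  have hder : ∀ s ∈ Set.Icc (0 : ℝ) 1, HasDerivWithinAt
      (fun s : ℝ => NormedSpace.exp (s • D) v - s • D v)
      (NormedSpace.exp (s • D) (D v) - D v) (Set.Icc 0 1) s := by
    intro s _
    have h2 : HasDerivAt (fun s : ℝ => s • D v) (D v) s := by
      simpa using (hasDerivAt_id s).smul_const (D v)
    exact ((hasDerivAt_exp_smul_apply D v s).sub h2).hasDerivWithinAt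
  -- Mean value inequality on `[0, 1]`: the derivative is `(exp(sD) - 1)(D v)`, and `exp(sD)` is
  -- within `c` of `1`.
  have := norm_image_sub_le_of_norm_deriv_le_segment_01' hder (C := c * ‖D v‖) fun s hs => by
    have hs' : dist (s • D) 0 < ε := by
      rw [dist_zero_right, norm_smul, Real.norm_of_nonneg hs.1]
      nlinarith [norm_nonneg D, hs.2]
    have h1 := (h hs').le
    rw [dist_eq_norm] at h1
    exact ((NormedSpace.exp (s • D) - 1).le_opNorm (D v)).trans
      (mul_le_mul_of_nonneg_right h1 (norm_nonneg _))
  simp only [one_smul, zero_smul, NormedSpace.exp_zero, sub_zero,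
    one_apply_eq_self] at this
  rwa [sub_right_comm] at this

variable (G : ClosedSubgroup (OrthGroup V))

/-- If `exp B_j ∈ G` for small nonzero `B_j → 0`, every limit of the directions `B_j / ‖B_j‖` lies
in the Lie algebra. -/
theorem mem_lieAlg_of_tendsto {B : ℕ → V →L[ℝ] V} {L : V →L[ℝ] V}
    (hB : Tendsto B atTop (𝓝 0)) (hne : ∀ j, B j ≠ 0)
    (hG : ∀ j, ∃ k : OrthGroup V, k ∈ G ∧ (k : V →L[ℝ] V) = NormedSpace.exp (B j))
    (hL : Tendsto (fun j => ‖B j‖⁻¹ • B j) atTop (𝓝 L)) : L ∈ lieAlg G := by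
  let _ : NormedAlgebra ℚ (V →L[ℝ] V) := NormedAlgebra.restrictScalars ℚ ℝ _
  intro t
  -- The integer powers `exp(B_j)^⌊t/‖B_j‖⌋` stay in `G` and converge to `exp(tL)`.
  have h1 : Tendsto (fun j => (⌊t / ‖B j‖⌋ : ℝ) * ‖B j‖) atTop (𝓝 t) := by
    have h2 : Tendsto (fun j => ‖B j‖) atTop (𝓝 0) := by simpa using hB.norm
    have h3 : Tendsto (fun j => t - ‖B j‖) atTop (𝓝 t) := by simpa using h2.const_sub t
    refine tendsto_of_tendsto_of_tendsto_of_le_of_le h3 tendsto_const_nhds (fun j => ?_)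
      fun j => ?_
    · have hpos := norm_pos_iff.2 (hne j)
      have := (Int.lt_floor_add_one (t / ‖B j‖)).le
      rw [div_le_iff₀ hpos] at this
      change t - ‖B j‖ ≤ _
      linarith
    · have hpos := norm_pos_iff.2 (hne j)
      exact (le_div_iff₀ hpos).1 (Int.floor_le _)
  have h2 : Tendsto (fun j => NormedSpace.exp (((⌊t / ‖B j‖⌋ : ℤ)) • B j)) atTop
      (𝓝 (NormedSpace.exp (t • L))) := by
    refine (NormedSpace.exp_continuous.tendsto _).comp ?_
    refine (h1.smul hL).congr fun j => ?_
    rw [smul_smul, mul_assoc, mul_inv_cancel₀ (norm_ne_zero_iff.2 (hne j)), mul_one,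
      Int.cast_smul_eq_zsmul]
  obtain ⟨k, hk, hk'⟩ := (isClosed_image G).mem_of_tendsto h2 (Eventually.of_forall fun j => by
    obtain ⟨k, hk, hk'⟩ := hG j
    refine ⟨k ^ ⌊t / ‖B j‖⌋, zpow_mem hk _, ?_⟩
    -- For negative `t` the exponent is negative, so the powers are compared in the group of units.
    have hu : Unitary.toUnits k ^ ⌊t / ‖B j‖⌋ = Unitary.toUnits (k ^ ⌊t / ‖B j‖⌋) :=
      (map_zpow _ _ _).symm
    have he : ∀ z : ℤ, NormedSpace.exp (z • B j)
        = ((Unitary.toUnits k ^ z : (V →L[ℝ] V)ˣ) : V →L[ℝ] V) := by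
      intro z
      have hinv : ∀ n : ℕ, NormedSpace.exp ((n : ℤ) • B j)
          = ((Unitary.toUnits k ^ (n : ℤ) : (V →L[ℝ] V)ˣ) : V →L[ℝ] V) := by
        intro n
        rw [natCast_zsmul, NormedSpace.exp_nsmul, ← hk', zpow_natCast, Units.val_pow_eq_pow_val]
        rfl
      obtain ⟨n, rfl | rfl⟩ := z.eq_nat_or_neg
      · exact hinv n
      · rw [zpow_neg]
        refine (Units.inv_eq_of_mul_eq_one_right ?_).symm
        rw [← hinv, ← NormedSpace.exp_add_of_commute, neg_smul, add_neg_cancel,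
          NormedSpace.exp_zero]
        rw [neg_smul]
        exact (Commute.refl _).neg_right
    change ((k ^ ⌊t / ‖B j‖⌋ : OrthGroup V) : V →L[ℝ] V) = _
    rw [he, hu]
    rfl)
  exact ⟨k, hk, hk'⟩

/-- Near `0`, a complement of the Lie algebra contains no nonzero `B` with `exp B ∈ G`. -/
theorem eventually_eq_zero_of_exp_mem {m : Submodule ℝ (V →L[ℝ] V)} (hm : Disjoint (lieAlg G) m) :
    ∀ᶠ B in 𝓝 (0 : V →L[ℝ] V), B ∈ m →
      (∃ k : OrthGroup V, k ∈ G ∧ (k : V →L[ℝ] V) = NormedSpace.exp B) → B = 0 := by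
  by_contra hcon
  rw [not_eventually] at hcon
  obtain ⟨B, hB, hB'⟩ := exists_seq_forall_of_frequently hcon
  push Not at hB'
  obtain ⟨L, hL, φ, hφ, hlim⟩ := (isCompact_sphere (0 : V →L[ℝ] V) 1).tendsto_subseq
    (x := fun j => ‖B j‖⁻¹ • B j) fun j => by
      rw [mem_sphere_zero_iff_norm, norm_smul, norm_inv, norm_norm,
        inv_mul_cancel₀ (norm_ne_zero_iff.2 (hB' j).2.2)]
  have h1 : L ∈ lieAlg G := mem_lieAlg_of_tendsto G (hB.comp hφ.tendsto_atTop)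
    (fun j => (hB' (φ j)).2.2) (fun j => (hB' (φ j)).2.1) hlim
  have h2 : L ∈ m := m.closed_of_finiteDimensional.mem_of_tendsto hlim
    (Eventually.of_forall fun j => m.smul_mem _ (hB' (φ j)).1)
  have h3 : L = 0 := Submodule.disjoint_def.1 hm L h1 h2
  rw [mem_sphere_zero_iff_norm, h3, norm_zero] at hL
  exact zero_ne_one hL

theorem hasStrictFDerivAt_exp_mul_exp {R : Type*} [NormedRing R] [NormedAlgebra ℝ R]
    [CompleteSpace R] :
    HasStrictFDerivAt (fun p : R × R => NormedSpace.exp p.1 * NormedSpace.exp p.2)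
      (ContinuousLinearMap.fst ℝ R R + ContinuousLinearMap.snd ℝ R R) 0 := by
  have e0 : HasStrictFDerivAt (NormedSpace.exp : R → R) (1 : R →L[ℝ] R) 0 :=
    hasStrictFDerivAt_exp_zero
  have h1 : HasStrictFDerivAt (fun p : R × R => NormedSpace.exp p.1)
      (ContinuousLinearMap.fst ℝ R R) 0 :=
    HasStrictFDerivAt.comp (0 : R × R) (g := NormedSpace.exp) (f := Prod.fst) e0
      hasStrictFDerivAt_fst
  have h2 : HasStrictFDerivAt (fun p : R × R => NormedSpace.exp p.2)
      (ContinuousLinearMap.snd ℝ R R) 0 :=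
    HasStrictFDerivAt.comp (0 : R × R) (g := NormedSpace.exp) (f := Prod.snd) e0
      hasStrictFDerivAt_snd
  refine (h1.mul' h2).congr_fderiv ?_
  refine ContinuousLinearMap.ext fun p => ?_
  simp [NormedSpace.exp_zero, add_comm]

/-- The exponential map covers a neighbourhood of the identity of `G`. -/
theorem exists_expG_eq {ε : ℝ} (hε : 0 < ε) :
    ∀ᶠ g in 𝓝 (1 : G.toSubgroup), ∃ D : lieAlg G, ‖D‖ < ε ∧ expG G D = g := by
  obtain ⟨m, hm⟩ := (lieAlg G).exists_isCompl
  let Φ : lieAlg G × m → (V →L[ℝ] V) := fun p =>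
    NormedSpace.exp (p.1 : V →L[ℝ] V) * NormedSpace.exp (p.2 : V →L[ℝ] V)
  let Φ' : lieAlg G × m →L[ℝ] (V →L[ℝ] V) :=
    (lieAlg G).subtypeL.comp (ContinuousLinearMap.fst ℝ _ _) +
      m.subtypeL.comp (ContinuousLinearMap.snd ℝ _ _)
  have hΦ : HasStrictFDerivAt Φ Φ' 0 :=
    HasStrictFDerivAt.comp (0 : lieAlg G × m) (f := (lieAlg G).subtypeL.prodMap m.subtypeL)
      (g := fun p : (V →L[ℝ] V) × (V →L[ℝ] V) => NormedSpace.exp p.1 * NormedSpace.exp p.2)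
      hasStrictFDerivAt_exp_mul_exp (ContinuousLinearMap.hasStrictFDerivAt _)
  have hsurj : Φ'.range = ⊤ := by
    rw [LinearMap.range_eq_top]
    intro A
    obtain ⟨a, ha, b, hb, rfl⟩ := Submodule.mem_sup.1
      (show A ∈ lieAlg G ⊔ m by rw [hm.sup_eq_top]; trivial)
    exact ⟨(⟨a, ha⟩, ⟨b, hb⟩), rfl⟩
  have hmap := HasStrictFDerivAt.map_nhds_eq_of_surj (𝕜 := ℝ) (E := lieAlg G × m) (F := V →L[ℝ] V) hΦ hsurj
  have hΦ0 : Φ 0 = 1 := by simp [Φ, NormedSpace.exp_zero]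
  rw [hΦ0] at hmap
  have hcoe : Tendsto (fun k : G.toSubgroup => (k.1.1 : V →L[ℝ] V)) (𝓝 1) (𝓝 1) :=
    (continuous_subtype_val.comp continuous_subtype_val).tendsto 1
  rw [← hmap] at hcoe
  have hN1 : ∀ᶠ p in 𝓝 (0 : lieAlg G × m), ‖p.1‖ < ε := by
    have : Tendsto (fun p : lieAlg G × m => ‖p.1‖) (𝓝 0) (𝓝 0) := by
      have h := (continuous_fst.norm : Continuous fun p : lieAlg G × m => ‖p.1‖).tendsto 0
      simpa using h
    exact this.eventually (gt_mem_nhds hε)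
  have hN2 : ∀ᶠ p in 𝓝 (0 : lieAlg G × m), (∃ k : OrthGroup V, k ∈ G ∧
      (k : V →L[ℝ] V) = NormedSpace.exp (p.2 : V →L[ℝ] V)) → (p.2 : V →L[ℝ] V) = 0 := by
    have h := (continuous_subtype_val.comp continuous_snd :
      Continuous fun p : lieAlg G × m => (p.2 : V →L[ℝ] V)).tendsto 0
    filter_upwards [h.eventually (eventually_eq_zero_of_exp_mem G hm.disjoint)] with p hp
    exact hp p.2.2
  have hN := hcoe.eventually (image_mem_map (hN1.and hN2))
  filter_upwards [hN] with g hg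
  obtain ⟨p, ⟨hp1, hp2⟩, hp3⟩ := hg
  -- If `g = exp(a) exp(b)` with `a ∈ 𝔤` and `b` in the complement, then `exp(b) = exp(a)⁻¹ g` is in
  -- `G`, which forces the small `b` to vanish.
  have hB : (p.2 : V →L[ℝ] V) = 0 := by
    refine hp2 ⟨((expG G p.1)⁻¹ * g).1, ((expG G p.1)⁻¹ * g).2, ?_⟩
    change ((expG G p.1)⁻¹).1.1 * g.1.1 = _
    rw [← hp3, ← mul_assoc]
    have := coe_mul_coe_inv (expG G p.1)⁻¹
    rw [inv_inv] at this
    change ((expG G p.1)⁻¹).1.1 * (expG G p.1).1.1 * _ = _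
    rw [this, one_mul]
  refine ⟨p.1, hp1, ?_⟩
  refine Subtype.ext (Subtype.ext ?_)
  rw [← hp3]
  simp only [Φ]
  rw [hB, NormedSpace.exp_zero, mul_one]
  rfl

end Logarithm

/-! ### Conjugation into a closed subgroup of a compact group. -/

section CompactGroup

/-- In a compact group `c⁻¹` is a cluster point of the powers `cⁿ`, `n ≥ 0`. All of these conjugate
`H` into itself, and this is a closed condition. -/
theorem inv_conj_mem_of_conj_mem {K : Type*} [Group K] [TopologicalSpace K] [IsTopologicalGroup K]
    [CompactSpace K] {H : Subgroup K} (hH : IsClosed (H : Set K)) {c : K}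
    (hc : ∀ k ∈ H, c * k * c⁻¹ ∈ H) {k : K} (hk : k ∈ H) : c⁻¹ * k * c ∈ H := by
  have hS : IsClosed {y : K | y * k * y⁻¹ ∈ H} := by
    refine hH.preimage ?_
    fun_prop
  have hpow : ∀ n : ℕ, c ^ n * k * (c ^ n)⁻¹ ∈ H := by
    intro n
    induction n with
    | zero => simpa using hk
    | succ n ih =>
      have := hc _ ih
      rw [pow_succ']
      simpa [mul_assoc] using this
  have hcl : MapClusterPt (c ^ (-1 : ℤ)) atTop (fun n : ℕ => c ^ n) :=
    mapClusterPt_self_zpow_atTop_pow c (-1)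
  have hmem : c ^ (-1 : ℤ) ∈ {y : K | y * k * y⁻¹ ∈ H} := by
    rw [← hS.closure_eq, mem_closure_iff_clusterPt]
    exact ClusterPt.mono hcl (tendsto_principal.2 (Eventually.of_forall hpow))
  simpa using hmem

end CompactGroup

/-! ### Limits of isotropy groups; principal points of `Ω₀`. -/

section Orbits

variable {V : Type*} [NormedAddCommGroup V] [InnerProductSpace ℝ V] [FiniteDimensional ℝ V]
  {G : ClosedSubgroup (OrthGroup V)}

theorem isClosed_stabilizer (x : V) :
    IsClosed (MulAction.stabilizer G.toSubgroup x : Set G.toSubgroup) :=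
  isClosed_eq (continuous_id.smul continuous_const) continuous_const

theorem exists_conj_of_mem_regSet {x : V} (hx : x ∈ regSet G) (y : V) :
    ∃ c : G.toSubgroup, ∀ k : G.toSubgroup, k • x = x → (c * k * c⁻¹) • y = y :=
  hx.2.2 y trivial

/-- Near a principal point, two points of one orbit differ by a small group element. -/
theorem eventually_exists_small_smul_eq {x : V} (hx : x ∈ regSet G) {N : Set G.toSubgroup}
    (hN : N ∈ 𝓝 1) :
    ∀ᶠ p in 𝓝 (x, x), ∀ g : G.toSubgroup, g • p.1 = p.2 → ∃ u ∈ N, u • p.1 = p.2 := by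
  by_contra hcon
  rw [not_eventually] at hcon
  obtain ⟨p, hp, hp'⟩ := exists_seq_forall_of_frequently hcon
  push Not at hp'
  choose g hg hgN using hp'
  choose c hc using fun n => exists_conj_of_mem_regSet hx (p n).1
  obtain ⟨⟨g₀, c₀⟩, φ, hφ, hlim⟩ := CompactSpace.tendsto_subseq fun n => (g n, c n)
  have hg₀ := hlim.fst_nhds
  have hc₀ := hlim.snd_nhds
  have hp1 := (hp.comp hφ.tendsto_atTop).fst_nhds
  have hp2 := (hp.comp hφ.tendsto_atTop).snd_nhds
  have hgx : g₀ • x = x :=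
    tendsto_nhds_unique ((hg₀.smul hp1).congr fun n => hg (φ n)) hp2
  have hcx : ∀ k : G.toSubgroup, k • x = x → (c₀ * k * c₀⁻¹) • x = x := fun k hk =>
    tendsto_nhds_unique
      ((((hc₀.mul_const k).mul hc₀.inv).smul hp1).congr fun n => hc (φ n) k hk) hp1
  have hh : (c₀⁻¹ * g₀ * c₀) • x = x :=
    inv_conj_mem_of_conj_mem (isClosed_stabilizer x) hcx hgx
  set h := c₀⁻¹ * g₀ * c₀ with hh_def
  -- The factor `c h⁻¹ c⁻¹` fixes the first point of the pair, so multiplying `g` by it keeps the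
  -- image; `h` is chosen so that the limit becomes `1`.
  have hu : Tendsto (fun n => g (φ n) * (c (φ n) * h⁻¹ * (c (φ n))⁻¹)) atTop (𝓝 1) := by
    have := hg₀.mul ((hc₀.mul_const h⁻¹).mul hc₀.inv)
    have h1 : g₀ * (c₀ * h⁻¹ * c₀⁻¹) = 1 := by rw [hh_def]; group
    rwa [h1] at this
  obtain ⟨n, hn⟩ := (hu.eventually hN).exists
  refine hgN (φ n) _ hn ?_
  rw [mul_smul, hc (φ n) h⁻¹ (inv_smul_eq_iff.2 hh.symm), hg]

/-- To first order, orbits move in tangential directions. -/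
theorem eventually_inner_smul_sub_le (y : V) {c : ℝ} (hc : 0 < c) :
    ∀ᶠ g in 𝓝 (1 : G.toSubgroup), ∀ u : V, (∀ A ∈ lieAlg G, ⟪A y, u⟫ = 0) →
      ⟪g • y - y, u⟫ ≤ c * ‖g • y - y‖ * ‖u‖ := by
  -- The bound `1/2` gives `‖D y‖ ≤ 2‖s‖` for the displacement `s`; then `c/2` makes the error at
  -- most `c‖s‖`.
  obtain ⟨ε, hε, h⟩ := exists_norm_exp_apply_sub_le (V := V) (c := min (c / 2) (1 / 2))
    (by positivity)
  filter_upwards [exists_expG_eq G hε] with g hg u hu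
  obtain ⟨D, hD, rfl⟩ := hg
  have h1 := h D hD y
  rw [expG_smul]
  set s := NormedSpace.exp (D : V →L[ℝ] V) y - y
  have h2 : ‖(D : V →L[ℝ] V) y‖ ≤ 2 * ‖s‖ := by
    have h3 := norm_sub_norm_le ((D : V →L[ℝ] V) y) s
    rw [norm_sub_rev ((D : V →L[ℝ] V) y) s] at h3
    have h4 := mul_le_mul_of_nonneg_right (min_le_right (c / 2) (1 / 2))
      (norm_nonneg ((D : V →L[ℝ] V) y))
    linarith
  have h5 : ⟪s, u⟫ = ⟪s - (D : V →L[ℝ] V) y, u⟫ := by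
    rw [inner_sub_left s, hu _ D.2, sub_zero]
  rw [h5]
  refine (real_inner_le_norm _ _).trans (mul_le_mul_of_nonneg_right ?_ (norm_nonneg u))
  have h4 := mul_le_mul_of_nonneg_right (min_le_left (c / 2) (1 / 2))
      (norm_nonneg ((D : V →L[ℝ] V) y))
  have h6 := mul_le_mul_of_nonneg_left h2 hc.le
  linarith

/-- Conjugation by `k` preserves `𝔤`, so the isotropy group of `y` preserves `𝔤 y` and hence its
orthogonal complement. -/
theorem inner_apply_smul_eq_zero {y ν : V} (hν : ∀ A ∈ lieAlg G, ⟪A y, ν⟫ = 0) {k : G.toSubgroup}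
    (hk : k • y = y) : ∀ A ∈ lieAlg G, ⟪A y, k • ν⟫ = 0 := by
  intro A hA
  have h1 := hν _ (conj_mem_lieAlg k⁻¹ hA)
  rw [inv_inv] at h1
  change ⟪k⁻¹ • A (k • y), ν⟫ = 0 at h1
  rwa [hk, inner_smul_eq, inv_inv] at h1

/-- The isotropy group of a principal point is conjugate to a subgroup of the isotropy group of
every point of the zero level of the momentum map. -/
theorem exists_conj_of_mem_Omega {x : V} (hx : x ∈ regSet G) {w : V × V} (hw : w ∈ Omega G) :
    ∃ c : G.toSubgroup, ∀ k : G.toSubgroup, k • x = x → (c * k * c⁻¹) • w = w := by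
  obtain ⟨ν, y⟩ := w
  have hν : ∀ A ∈ lieAlg G, ⟪A y, ν⟫ = 0 := by
    intro A hA
    have := hw A hA
    rw [inner_apply_eq_neg hA, real_inner_comm]
    exact neg_eq_zero.2 this
  let t : ℕ → ℝ := fun n => 1 / ((n : ℝ) + 1)
  have ht : Tendsto t atTop (𝓝 0) := tendsto_one_div_add_atTop_nhds_zero_nat
  have htpos : ∀ n, 0 < t n := fun n => by positivity
  choose c hc using fun n => exists_conj_of_mem_regSet hx (y + t n • ν)
  obtain ⟨c₀, φ, hφ, hc₀⟩ := CompactSpace.tendsto_subseq c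
  refine ⟨c₀, fun k hk => ?_⟩
  let h : ℕ → G.toSubgroup := fun n => c (φ n) * k * (c (φ n))⁻¹
  set h₀ := c₀ * k * c₀⁻¹ with hh₀
  have hh : Tendsto h atTop (𝓝 h₀) := (hc₀.mul_const k).mul hc₀.inv
  have htφ := ht.comp hφ.tendsto_atTop
  have hpt : Tendsto (fun n => y + t (φ n) • ν) atTop (𝓝 y) := by
    have := (htφ.smul_const ν).const_add y
    simpa using this
  have hfix : ∀ n, h n • (y + t (φ n) • ν) = y + t (φ n) • ν := fun n => hc (φ n) k hk
  have hy : h₀ • y = y := tendsto_nhds_unique ((hh.smul hpt).congr hfix) hpt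
  -- The left side is a displacement along the orbit of `y`, tangential to first order. The bracket
  -- on the right tends to the normal vector `u`. Dividing by `t` leaves no room for a nonzero `u`.
  have hdiff : ∀ n, h n • y - y = t (φ n) • (ν - h n • ν) := by
    intro n
    have := hfix n
    rw [smul_add, smul_comm] at this
    rw [smul_sub, sub_eq_sub_iff_add_eq_add, this]
    abel
  set u := ν - h₀ • ν with hu
  have hu_perp : ∀ A ∈ lieAlg G, ⟪A y, u⟫ = 0 := fun A hA => by
    rw [hu, inner_sub_right, hν A hA, inner_apply_smul_eq_zero hν hy A hA, sub_zero]
  -- The first-order estimate needs group elements near `1`. Since `h₀` fixes `y`, `h n * h₀⁻¹`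
  -- moves `y` exactly as `h n` does.
  have hlim : Tendsto (fun n => h n * h₀⁻¹) atTop (𝓝 1) := by
    have := hh.mul_const h₀⁻¹
    rwa [mul_inv_cancel] at this
  have hsm : ∀ n, (h n * h₀⁻¹) • y = h n • y := fun n => by
    rw [mul_smul, inv_smul_eq_iff.2 hy.symm]
  have hbound : ∀ ε : ℝ, 0 < ε → ‖u‖ ^ 2 ≤ ε * (2 * ‖ν‖) * ‖u‖ := by
    intro ε hε
    have h1 : Tendsto (fun n => ⟪ν - h n • ν, u⟫) atTop (𝓝 ⟪u, u⟫) :=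
      ((hh.smul_const ν).const_sub ν).inner tendsto_const_nhds
    rw [← real_inner_self_eq_norm_sq]
    refine le_of_tendsto h1 ?_
    filter_upwards [hlim.eventually (eventually_inner_smul_sub_le y hε)] with n hn
    have h2 := hn u hu_perp
    rw [hsm, hdiff, real_inner_smul_left, norm_smul, Real.norm_of_nonneg (htpos _).le] at h2
    have h3 : ⟪ν - h n • ν, u⟫ ≤ ε * ‖ν - h n • ν‖ * ‖u‖ := by
      refine le_of_mul_le_mul_left ?_ (htpos (φ n))
      linarith
    refine h3.trans (mul_le_mul_of_nonneg_right (mul_le_mul_of_nonneg_left ?_ hε.le)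
      (norm_nonneg _))
    refine (norm_sub_le _ _).trans ?_
    rw [norm_smul_eq, two_mul]
  have hu0 : u = 0 := by
    by_contra hne
    have hpos := norm_pos_iff.2 hne
    -- This `ε` makes `ε · 2‖ν‖ < ‖u‖`, which contradicts `hbound`.
    have h1 := hbound (‖u‖ / (4 * (‖ν‖ + 1))) (by positivity)
    have h2 : ‖u‖ / (4 * (‖ν‖ + 1)) * (2 * ‖ν‖) < ‖u‖ := by
      rw [div_mul_eq_mul_div, div_lt_iff₀ (by positivity)]
      nlinarith [norm_nonneg ν]
    nlinarith
  rw [hu, sub_eq_zero] at hu0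
  exact Prod.ext hu0.symm hy

/-- The isotropy group of `z` lies in that of its second component, which is already conjugate into
every isotropy group on `Ω₀`. -/
theorem mem_regOmega {z : V × V} (hz : z ∈ Omega G) (hz2 : z.2 ∈ regSet G) : z ∈ regOmega G := by
  refine ⟨hz, ⟨z, hz, rfl⟩, fun w hw => ?_⟩
  obtain ⟨c, hc⟩ := exists_conj_of_mem_Omega hz2 hw
  exact ⟨c, fun k hk => hc k (congrArg Prod.snd hk)⟩

end Orbits

/-! ### Orbit dimensions, tangential frames and normal spaces at principal points. -/

section Dimension

variable {V : Type*} [NormedAddCommGroup V] [InnerProductSpace ℝ V] [FiniteDimensional ℝ V]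
  {G : ClosedSubgroup (OrthGroup V)}

theorem exp_smul_apply_of_apply_eq_zero {A : V →L[ℝ] V} {x : V} (h : A x = 0) (t : ℝ) :
    NormedSpace.exp (t • A) x = x := by
  have h1 : ∀ s : ℝ, HasDerivAt (fun s : ℝ => NormedSpace.exp (s • A) x) 0 s := by
    intro s
    have := hasDerivAt_exp_smul_apply A x s
    rwa [h, map_zero] at this
  have h2 := is_const_of_deriv_eq_zero (fun s => (h1 s).differentiableAt)
    (fun s => (h1 s).deriv) t 0
  simpa [NormedSpace.exp_zero] using h2

variable (G) in
/-- The infinitesimal action `A ↦ A x` at a point `x`. -/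
def infAction (x : V) : lieAlg G →ₗ[ℝ] V :=
  ((ContinuousLinearMap.apply ℝ V x : _ →L[ℝ] V) : _ →ₗ[ℝ] V) ∘ₗ (lieAlg G).subtype

theorem orbitDim_eq (x : V) : orbitDim G x = Module.finrank ℝ (LinearMap.range (infAction G x)) := by
  rw [orbitDim, infAction, LinearMap.range_comp, Submodule.range_subtype]

/-- Conjugation by `c` embeds the isotropy algebra of `x` into that of `y`; rank-nullity for `A ↦ A
x` and `A ↦ A y` reverses the inequality. -/
theorem orbitDim_le {x : V} (hx : x ∈ regSet G) (y : V) : orbitDim G y ≤ orbitDim G x := by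
  obtain ⟨c, hc⟩ := exists_conj_of_mem_regSet hx y
  have hker : ∀ A : lieAlg G, (A : V →L[ℝ] V) x = 0 →
      (c.1.1 * (A : V →L[ℝ] V) * (c⁻¹).1.1) y = 0 := by
    intro A hA
    have h1 := hasDerivAt_exp_smul_apply_zero (c.1.1 * (A : V →L[ℝ] V) * (c⁻¹).1.1) y
    have h2 : (fun s : ℝ => NormedSpace.exp (s • (c.1.1 * (A : V →L[ℝ] V) * (c⁻¹).1.1)) y)
        = fun _ => y := by
      funext s
      have h3 : (c * expG G (s • A) * c⁻¹) • y = y :=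
        hc _ (exp_smul_apply_of_apply_eq_zero hA s)
      rw [← smul_mul_assoc, ← mul_smul_comm, exp_conj_unitary]
      exact h3
    rw [h2] at h1
    exact h1.unique (hasDerivAt_const _ _)
  let Ad : LinearMap.ker (infAction G x) →ₗ[ℝ] LinearMap.ker (infAction G y) :=
    { toFun := fun A => ⟨⟨_, conj_mem_lieAlg c A.1.2⟩, hker A.1 A.2⟩
      map_add' := fun A B => by
        refine Subtype.ext (Subtype.ext ?_)
        change c.1.1 * (A.1.1 + B.1.1) * (c⁻¹).1.1 = c.1.1 * A.1.1 * _ + c.1.1 * B.1.1 * _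
        rw [mul_add, add_mul]
      map_smul' := fun r A => by
        refine Subtype.ext (Subtype.ext ?_)
        change c.1.1 * (r • A.1.1) * (c⁻¹).1.1 = r • (c.1.1 * A.1.1 * _)
        rw [mul_smul_comm, smul_mul_assoc] }
  have hinj : Function.Injective Ad := by
    intro A B hAB
    have h1 : c.1.1 * A.1.1 * (c⁻¹).1.1 = c.1.1 * B.1.1 * (c⁻¹).1.1 :=
      congrArg (fun A => A.1.1) hAB
    have h2 : (c⁻¹).1.1 * c.1.1 = (1 : V →L[ℝ] V) := by
      have := coe_mul_coe_inv c⁻¹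
      rwa [inv_inv] at this
    have h3 := congrArg (fun L => (c⁻¹).1.1 * L * c.1.1) h1
    simp only [mul_assoc, h2, mul_one] at h3
    simp only [← mul_assoc, h2, one_mul] at h3
    exact Subtype.ext (Subtype.ext h3)
  have h1 := LinearMap.finrank_le_finrank_of_injective hinj
  have h2 := (infAction G x).finrank_range_add_finrank_ker
  have h3 := (infAction G y).finrank_range_add_finrank_ker
  rw [orbitDim_eq, orbitDim_eq]
  omega

theorem orbitDim_eq_of_mem_regSet {x y : V} (hx : x ∈ regSet G) (hy : y ∈ regSet G) :
    orbitDim G x = orbitDim G y :=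
  le_antisymm (orbitDim_le hy x) (orbitDim_le hx y)

/-- The map `c ↦ M(c) y` for a linear family `M` of elements of the Lie algebra. -/
def frameMap {κ : ℕ} (M : Euc κ →L[ℝ] lieAlg G) (y : V) : Euc κ →L[ℝ] V :=
  (ContinuousLinearMap.apply ℝ V y).comp ((lieAlg G).subtypeL.comp M)

@[simp]
theorem frameMap_apply {κ : ℕ} (M : Euc κ →L[ℝ] lieAlg G) (y : V) (c : Euc κ) :
    frameMap M y c = (M c : V →L[ℝ] V) y := rfl

/-- `M` parametrizes the tangent space of the orbit of `x` isometrically. -/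
def IsOrbitFrame {κ : ℕ} (M : Euc κ →L[ℝ] lieAlg G) (x : V) : Prop :=
  κ = orbitDim G x ∧ ∀ c d : Euc κ, ⟪frameMap M x c, frameMap M x d⟫ = ⟪c, d⟫

/-- An orthonormal basis of `𝔤 x` is lifted to `𝔤` by a linear section of `A ↦ A x`. -/
theorem exists_isOrbitFrame {κ : ℕ} {x : V} (hκ : κ = orbitDim G x) :
    ∃ M : Euc κ →L[ℝ] lieAlg G, IsOrbitFrame M x := by
  let T := LinearMap.range (infAction G x)
  have hT : Module.finrank ℝ T = κ := by rw [hκ, orbitDim_eq]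
  let e : T ≃ₗᵢ[ℝ] Euc κ := ((stdOrthonormalBasis ℝ T).reindex (finCongr hT)).repr
  obtain ⟨σ, hσ⟩ := (infAction G x).rangeRestrict.exists_rightInverse_of_surjective
    (LinearMap.range_rangeRestrict _)
  refine ⟨LinearMap.toContinuousLinearMap (σ ∘ₗ e.symm.toLinearEquiv.toLinearMap), hκ,
    fun c d => ?_⟩
  have h : ∀ c, ((infAction G x) (σ (e.symm c)) : V) = (e.symm c : V) := fun c =>
    congrArg Subtype.val (LinearMap.congr_fun hσ (e.symm c))
  change ⟪infAction G x (σ (e.symm c)), infAction G x (σ (e.symm d))⟫ = _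
  rw [h, h, ← Submodule.coe_inner, e.symm.inner_map_map]

/-- The adjoint of the frame map at `x`; it computes the tangential component at `x`. -/
def frameProj {κ : ℕ} (M : Euc κ →L[ℝ] lieAlg G) (x : V) : V →L[ℝ] Euc κ :=
  ContinuousLinearMap.adjoint (frameMap M x)

theorem inner_frameProj {κ : ℕ} (M : Euc κ →L[ℝ] lieAlg G) (x v : V) (c : Euc κ) :
    ⟪c, frameProj M x v⟫ = ⟪frameMap M x c, v⟫ :=
  ContinuousLinearMap.adjoint_inner_right _ _ _

theorem frameProj_eq_zero_iff {κ : ℕ} (M : Euc κ →L[ℝ] lieAlg G) (x v : V) :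
    frameProj M x v = 0 ↔ ∀ c, ⟪frameMap M x c, v⟫ = 0 := by
  simp only [← inner_frameProj]
  refine ⟨fun h c => by rw [h, inner_zero_right], fun h => ?_⟩
  exact inner_self_eq_zero.1 (h (frameProj M x v))

variable {κ : ℕ} {M : Euc κ →L[ℝ] lieAlg G} {x : V}

theorem IsOrbitFrame.frameProj_frameMap (hM : IsOrbitFrame M x) (c : Euc κ) :
    frameProj M x (frameMap M x c) = c := by
  refine ext_inner_left ℝ fun d => ?_
  rw [inner_frameProj, hM.2]

theorem IsOrbitFrame.norm_frameMap (hM : IsOrbitFrame M x) (c : Euc κ) :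
    ‖frameMap M x c‖ = ‖c‖ := by
  have := hM.2 c c
  rw [real_inner_self_eq_norm_sq, real_inner_self_eq_norm_sq] at this
  exact (pow_left_inj₀ (norm_nonneg _) (norm_nonneg _) two_ne_zero).1 this

theorem IsOrbitFrame.norm_frameProj_le (hM : IsOrbitFrame M x) (v : V) :
    ‖frameProj M x v‖ ≤ ‖v‖ := by
  have h1 := inner_frameProj M x v (frameProj M x v)
  rw [real_inner_self_eq_norm_sq] at h1
  have h2 := real_inner_le_norm (frameMap M x (frameProj M x v)) v
  rw [← h1, hM.norm_frameMap] at h2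
  by_contra hlt
  push Not at hlt
  nlinarith [norm_nonneg v]

/-- Near a principal point the frame still parametrizes the tangent spaces of the orbits, and these
remain transverse to the normal space at that point. -/
theorem IsOrbitFrame.eventually_frame (hM : IsOrbitFrame M x) (hx : x ∈ regSet G) :
    ∀ᶠ y in 𝓝 x, (∀ D : lieAlg G, ∃ c, (D : V →L[ℝ] V) y = frameMap M y c) ∧
      ∀ c, ‖frameMap M y c‖ ≤ 2 * ‖frameProj M x (frameMap M y c)‖ := by
  have hcont : Continuous fun y => frameMap M y := by
    unfold frameMap
    exact (ContinuousLinearMap.apply ℝ V).continuous.clm_comp continuous_const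
  -- With `1/8` the frame at `y` has norm at most `9/8` and its projection is bounded below by
  -- `7/8`, and `9/8 ≤ 2 · 7/8`.
  have hclose : ∀ᶠ y in 𝓝 x, ‖frameMap M y - frameMap M x‖ < 1 / 8 := by
    have h : Tendsto (fun y => ‖frameMap M y - frameMap M x‖) (𝓝 x)
        (𝓝 ‖frameMap M x - frameMap M x‖) := ((hcont.tendsto x).sub_const _).norm
    rw [sub_self, norm_zero] at h
    exact h.eventually (gt_mem_nhds (by norm_num))
  filter_upwards [hclose] with y hy
  have hdiff : ∀ c, ‖frameMap M y c - frameMap M x c‖ ≤ 1 / 8 * ‖c‖ := fun c =>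
    ((frameMap M y - frameMap M x).le_opNorm c).trans
      (mul_le_mul_of_nonneg_right hy.le (norm_nonneg c))
  have hlow : ∀ c, 7 / 8 * ‖c‖ ≤ ‖frameProj M x (frameMap M y c)‖ := by
    intro c
    have h1 := (hM.norm_frameProj_le (frameMap M y c - frameMap M x c)).trans (hdiff c)
    rw [map_sub, hM.frameProj_frameMap] at h1
    have h2 := norm_sub_norm_le c (frameProj M x (frameMap M y c))
    rw [norm_sub_rev] at h2
    linarith
  have hup : ∀ c, ‖frameMap M y c‖ ≤ 9 / 8 * ‖c‖ := by
    intro c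
    have h1 := norm_sub_norm_le (frameMap M y c) (frameMap M x c)
    rw [hM.norm_frameMap] at h1
    linarith [hdiff c]
  refine ⟨?_, fun c => ?_⟩
  · have hinj : Function.Injective (frameMap M y : Euc κ →ₗ[ℝ] V) := by
      rw [← LinearMap.ker_eq_bot, LinearMap.ker_eq_bot']
      intro c hc
      have h1 := hlow c
      rw [show frameMap M y c = 0 from hc, map_zero, norm_zero] at h1
      exact norm_le_zero_iff.1 (by linarith)
    have hle : LinearMap.range (frameMap M y : Euc κ →ₗ[ℝ] V) ≤ LinearMap.range (infAction G y) := by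
      rintro _ ⟨c, rfl⟩
      exact ⟨M c, rfl⟩
    -- The frame at `y` has rank `κ`, and no orbit has dimension greater than that of a principal
    -- one.
    have heq := Submodule.eq_of_le_of_finrank_le hle (by
      rw [LinearMap.finrank_range_of_inj hinj, ← orbitDim_eq, finrank_euclideanSpace_fin, hM.1]
      exact orbitDim_le hx y)
    intro D
    obtain ⟨c, hc⟩ := heq.ge ⟨D, rfl⟩
    exact ⟨c, hc.symm⟩
  · have h1 := hlow c
    have h2 := hup c
    have h3 := norm_nonneg c
    linarith

/-- Two points of an orbit near a principal point coincide if their difference is normal. -/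
theorem IsOrbitFrame.eventually_eq_of_frameProj_eq_zero (hM : IsOrbitFrame M x)
    (hx : x ∈ regSet G) :
    ∀ᶠ p in 𝓝 (x, x), ∀ g : G.toSubgroup, g • p.1 = p.2 →
      frameProj M x (p.2 - p.1) = 0 → p.2 = p.1 := by
  -- Let `q = exp(D) p` with `q - p` normal. The projection of `D p` is then at most `‖D p‖ / 4`,
  -- but by transversality at least `‖D p‖ / 2`; hence `D p = 0`.
  obtain ⟨ε, hε, hexp⟩ := exists_norm_exp_apply_sub_le (V := V) (c := 1 / 4) (by norm_num)
  filter_upwards [eventually_exists_small_smul_eq hx (exists_expG_eq G hε),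
    (continuous_fst.tendsto (x, x)).eventually (hM.eventually_frame hx)] with p hp hp' g hg hproj
  obtain ⟨_, ⟨D, hD, rfl⟩, hu⟩ := hp g hg
  rw [expG_smul] at hu
  have h1 := hexp D hD p.1
  rw [hu] at h1
  obtain ⟨c, hc⟩ := hp'.1 D
  have h2 := hp'.2 c
  rw [← hc] at h2
  have h3 := hM.norm_frameProj_le (p.2 - p.1 - (D : V →L[ℝ] V) p.1)
  rw [map_sub, hproj, zero_sub, norm_neg] at h3
  have h4 : ‖(D : V →L[ℝ] V) p.1‖ ≤ 0 := by linarith [norm_nonneg ((D : V →L[ℝ] V) p.1)]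
  rw [norm_le_zero_iff.1 h4, norm_zero, mul_zero, sub_zero] at h1
  exact sub_eq_zero.1 (norm_le_zero_iff.1 h1)

/-- The isotropy group of a principal point acts trivially on the normal space of the orbit. -/
theorem smul_eq_of_normal {x : V} (hx : x ∈ regSet G) {ν : V}
    (hν : ∀ A ∈ lieAlg G, ⟪A x, ν⟫ = 0) {k : G.toSubgroup} (hk : k • x = x) : k • ν = ν := by
  obtain ⟨M, hM⟩ := exists_isOrbitFrame (G := G) (x := x) rfl
  -- As `k` fixes `x`, it carries `x + tν` to `x + t kν`. Their difference is normal, so they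
  -- coincide for some small `t ≠ 0`.
  have hcurve : Tendsto (fun t : ℝ => (x + t • ν, x + t • k • ν)) (𝓝[≠] 0) (𝓝 (x, x)) := by
    have h : Continuous fun t : ℝ => (x + t • ν, x + t • k • ν) := by fun_prop
    have := h.tendsto 0
    simp only [zero_smul, add_zero] at this
    exact this.mono_left nhdsWithin_le_nhds
  obtain ⟨t, ht, ht0⟩ := ((hcurve.eventually (hM.eventually_eq_of_frameProj_eq_zero hx)).and
    self_mem_nhdsWithin).exists
  have h1 := ht k (by rw [smul_add, hk, smul_comm]) (by
    rw [frameProj_eq_zero_iff]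
    intro c
    have h2 : (x + t • k • ν) - (x + t • ν) = t • (k • ν - ν) := by
      rw [smul_sub]; abel
    change ⟪_, (x + t • k • ν) - (x + t • ν)⟫ = 0
    rw [h2, inner_smul_right, inner_sub_right, frameMap_apply, hν _ (M c).2,
      inner_apply_smul_eq_zero hν hk _ (M c).2]
    simp)
  exact smul_right_injective V ht0 (add_left_cancel h1)

end Dimension

/-! ### Curves in level sets and stability of surjectivity. -/

section Calculus

variable {E F : Type*} [NormedAddCommGroup E] [NormedSpace ℝ E] [NormedAddCommGroup F]
  [NormedSpace ℝ F] [FiniteDimensional ℝ F]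

/-- Every kernel vector of a surjective derivative is the velocity of a curve in the level set. -/
theorem exists_curve_of_mem_ker [FiniteDimensional ℝ E] {f : E → F} {f' : E →L[ℝ] F}
    (hf : HasStrictFDerivAt f f' 0) (hsurj : Function.Surjective f') (hf0 : f 0 = 0) {v : E} (hv : f' v = 0) {U : Set E}
    (hU : U ∈ 𝓝 0) :
    ∃ γ : ℝ → E, γ 0 = 0 ∧ HasDerivAt γ v 0 ∧ ∀ t, γ t ∈ U ∧ f (γ t) = 0 := by
  have hrange : f'.range = ⊤ := LinearMap.range_eq_top.2 hsurj
  let v' : f'.ker := ⟨v, hv⟩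
  let γ : ℝ → E := fun t => hf.implicitFunction f f' hrange (f 0) (t • v')
  have hγ0 : γ 0 = 0 := by
    simp only [γ, zero_smul]
    exact hf.implicitFunction_apply_image hrange
  have hγ : HasDerivAt γ v 0 := by
    have h1 : HasDerivAt (fun t : ℝ => t • v') v' 0 := by
      simpa using (hasDerivAt_id (0 : ℝ)).smul_const v'
    have h2 : HasFDerivAt (hf.implicitFunction f f' hrange (f 0)) f'.ker.subtypeL
        ((0 : ℝ) • v') := by
      rw [zero_smul]
      exact (hf.to_implicitFunction hrange).hasFDerivAt
    exact h2.comp_hasDerivAt 0 h1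
  have hmem : ∀ᶠ t in 𝓝 (0 : ℝ), γ t ∈ U ∧ f (γ t) = 0 := by
    have hU' : ∀ᶠ t in 𝓝 (0 : ℝ), γ t ∈ U := by
      have := hγ.continuousAt.tendsto
      rw [hγ0] at this
      exact this.eventually hU
    have hpair : Tendsto (fun t : ℝ => (f 0, t • v')) (𝓝 0) (𝓝 (f 0, 0)) := by
      have h : Continuous fun t : ℝ => (f 0, t • v') := by fun_prop
      simpa using h.tendsto 0
    filter_upwards [hU', hpair.eventually (hf.map_implicitFunction_eq hrange)] with t h1 h2
    exact ⟨h1, h2.trans hf0⟩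
  classical
  -- The curve must stay in the level set for all `t`; the default value `0` belongs to `U` and to
  -- the level set.
  refine ⟨fun t => if γ t ∈ U ∧ f (γ t) = 0 then γ t else 0, ?_, ?_, fun t => ?_⟩
  · simp [hγ0]
  · refine hγ.congr_of_eventuallyEq ?_
    filter_upwards [hmem] with t ht
    rw [if_pos ht]
  · by_cases h : γ t ∈ U ∧ f (γ t) = 0
    · simpa only [if_pos h] using h
    · simpa only [if_neg h] using ⟨mem_of_mem_nhds hU, hf0⟩

/-- Composed with a right inverse of the derivative at `0`, nearby derivatives are close to the
identity, hence invertible. -/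
theorem eventually_surjective_fderiv {f : E → F} (hf : ContDiff ℝ 1 f)
    (hsurj : Function.Surjective (fderiv ℝ f 0)) :
    ∀ᶠ w in 𝓝 (0 : E), Function.Surjective (fderiv ℝ f w) := by
  obtain ⟨σ, hσ⟩ := (fderiv ℝ f 0 : E →ₗ[ℝ] F).exists_rightInverse_of_surjective
    (LinearMap.range_eq_top.2 hsurj)
  let σ' : F →L[ℝ] E := LinearMap.toContinuousLinearMap σ
  have hcont : Continuous fun w => (fderiv ℝ f w).comp σ' :=
    (hf.continuous_fderiv one_ne_zero).clm_comp continuous_const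
  have h0 : (fderiv ℝ f 0).comp σ' = 1 :=
    ContinuousLinearMap.ext fun c => LinearMap.congr_fun hσ c
  have hunit : ∀ᶠ L in 𝓝 (1 : F →L[ℝ] F), IsUnit L :=
    Units.isOpen.mem_nhds isUnit_one
  have := hcont.tendsto 0
  rw [h0] at this
  filter_upwards [this.eventually hunit] with w hw
  obtain ⟨u, hu⟩ := hw
  intro c
  refine ⟨σ' (((u⁻¹ : (F →L[ℝ] F)ˣ) : F →L[ℝ] F) c), ?_⟩
  have h1 : (u : F →L[ℝ] F) * (u⁻¹ : (F →L[ℝ] F)ˣ) = 1 := u.mul_inv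
  rw [hu] at h1
  exact congrArg (fun L : F →L[ℝ] F => L c) h1

end Calculus

/-! ### Derivatives along lines. -/

section Lines

variable {E F : Type*} [NormedAddCommGroup E] [NormedSpace ℝ E] [NormedAddCommGroup F]
  [NormedSpace ℝ F]

theorem hasDerivAt_add_smul (x y : E) (t : ℝ) : HasDerivAt (fun t : ℝ => x + t • y) y t := by
  simpa using ((hasDerivAt_id t).smul_const y).const_add x

theorem hasDerivAt_clm_comp (L : E →L[ℝ] F) {γ : ℝ → E} {v : E} {t : ℝ}
    (h : HasDerivAt γ v t) : HasDerivAt (fun s => L (γ s)) (L v) t :=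
  L.hasFDerivAt.comp_hasDerivAt t h

theorem hasDerivAt_comp_line {f : E → F} (hf : Differentiable ℝ f) (v : E) (t : ℝ) :
    HasDerivAt (fun s : ℝ => f (s • v)) (fderiv ℝ f (t • v) v) t := by
  have h : HasDerivAt (fun s : ℝ => s • v) v t := by
    simpa using (hasDerivAt_id t).smul_const v
  exact (hf (t • v)).hasFDerivAt.comp_hasDerivAt t h

/-- The second derivative along a line through the origin. -/
theorem fderiv_fderiv_apply_self {f : E → F} (hf : ContDiff ℝ 2 f) {w : E} {g : ℝ → F} {q : F}
    (hg : ∀ t : ℝ, HasDerivAt (fun s : ℝ => f (s • w)) (g t) t) (hq : HasDerivAt g q 0) :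
    fderiv ℝ (fderiv ℝ f) 0 w w = q := by
  have hd : Differentiable ℝ (fderiv ℝ f) :=
    (hf.fderiv_right (m := 1) (by norm_num)).differentiable one_ne_zero
  have h1 := (hasDerivAt_comp_line hd w 0).clm_apply (hasDerivAt_const (0 : ℝ) w)
  have h2 : (fun t : ℝ => fderiv ℝ f (t • w) w) = g := funext fun t =>
    (hasDerivAt_comp_line (hf.differentiable two_ne_zero) w t).unique (hg t)
  simp only [map_zero, add_zero, zero_smul] at h1
  rw [h2] at h1
  exact h1.unique hq

end Lines

/-! ### Symmetric forms on a complement of their kernel. -/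

section LinearAlgebra

variable {E : Type*} [AddCommGroup E] [Module ℝ E] [FiniteDimensional ℝ E]

/-- A symmetric form is nondegenerate on every orthogonal complement of its kernel. -/
theorem nondegenerate_restrict_of_orthogonal {H b : LinearMap.BilinForm ℝ E}
    (hH : ∀ v w, H v w = H w v) (hb : b.IsSymm) (hpos : ∀ v, v ≠ 0 → 0 < b v v)
    {N : Submodule ℝ E} (hN : ∀ v, v ∈ N ↔ ∀ u, (∀ w, H u w = 0) → b u v = 0) :
    (H.restrict N).Nondegenerate := by
  let K : Submodule ℝ E := LinearMap.ker H
  have hK : ∀ u, u ∈ K ↔ ∀ w, H u w = 0 := fun u => by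
    rw [LinearMap.mem_ker, LinearMap.ext_iff]
    rfl
  have hdecomp : ∀ w : E, ∃ u ∈ K, ∃ v ∈ N, w = u + v := by
    intro w
    have hres : (b.restrict K).Nondegenerate := by
      refine ⟨fun u hu => ?_, fun u hu => ?_⟩ <;>
      · by_contra hne
        have := hpos u (fun h => hne (Subtype.ext h))
        exact this.ne' (hu u)
    have hcompl := LinearMap.BilinForm.isCompl_orthogonal_of_restrict_nondegenerate
      hb.isRefl hres
    obtain ⟨u, hu, v, hv, rfl⟩ := Submodule.mem_sup.1
      (show w ∈ K ⊔ b.orthogonal K by rw [hcompl.sup_eq_top]; trivial)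
    exact ⟨u, hu, v, (hN v).2 fun u' hu' => hv u' ((hK u').2 hu'), rfl⟩
  have key : ∀ v ∈ N, (∀ v' ∈ N, H v v' = 0) → v = 0 := by
    intro v hv h
    by_contra hne
    -- If `v ∈ N` is `H`-orthogonal to `N`, it is so to `K + N = E`. Thus `v` lies in the kernel and
    -- is `b`-orthogonal to itself.
    refine (hpos v hne).ne' ((hN v).1 hv v fun w => ?_)
    obtain ⟨u, hu, v', hv', rfl⟩ := hdecomp w
    rw [map_add, h v' hv', add_zero, hH, (hK u).1 hu]
  refine ⟨fun v hv => Subtype.ext (key v v.2 fun v' hv' => hv ⟨v', hv'⟩),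
    fun v hv => Subtype.ext (key v v.2 fun v' hv' => ?_)⟩
  rw [hH]
  exact hv ⟨v', hv'⟩

end LinearAlgebra

/-! ### First and second derivatives of the phase function. -/

section Phase

variable {V W : Type*} [NormedAddCommGroup V] [InnerProductSpace ℝ V] [FiniteDimensional ℝ V]
  [NormedAddCommGroup W] [InnerProductSpace ℝ W]

/-- The phase function `⟨(1 - k) R x, Z(η)⟩` for a family of covectors `Z(η)`. -/
def phase (G : ClosedSubgroup (OrthGroup V)) (R : V ≃ₗᵢ[ℝ] V) (Z : W → V)
    (p : PhaseSpace W G) : ℝ :=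
  ⟪R p.1 - p.2.2 • R p.1, Z p.2.1⟫

/-- `Z` parametrizes an affine hyperplane of `V` which misses the origin and has direction
`ι`. -/
structure IsAffineHyperplane (Z : W → V) (ι : W →L[ℝ] V) : Prop where
  map_add : ∀ e p, Z (e + p) = Z e + ι p
  eq_zero : ∀ e u, (∀ p, ⟪u, ι p⟫ = 0) → ⟪u, Z e⟫ = 0 → u = 0

variable {G : ClosedSubgroup (OrthGroup V)} {R : V ≃ₗᵢ[ℝ] V} {Z : W → V} {ι : W →L[ℝ] V}

theorem hasDerivAt_exp_smul_line (A : V →L[ℝ] V) (x y : V) (t : ℝ) :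
    HasDerivAt (fun t : ℝ => NormedSpace.exp (t • A) (x + t • y))
      (NormedSpace.exp (t • A) (A (x + t • y)) + NormedSpace.exp (t • A) y) t := by
  exact (hasDerivAt_exp_smul_const (𝕂 := ℝ) A t).clm_apply (hasDerivAt_add_smul x y t)

theorem phase_expChart (hZ : IsAffineHyperplane Z ι) (p : PhaseSpace W G) (w : ModelSpace W G) :
    phase G R Z (expChart G p w) = ⟪(R p.1 + R w.1) - NormedSpace.exp (w.2.2 : V →L[ℝ] V)
      (p.2.2 • R p.1 + p.2.2 • R w.1), Z p.2.1 + ι w.2.1⟫ := by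
  rw [phase]
  simp only [expChart, map_add, hZ.map_add, mul_smul, smul_add, expG_smul]

theorem contDiff_expMap {n : WithTop ℕ∞} : ContDiff ℝ n
    (fun w : ModelSpace W G => NormedSpace.exp (w.2.2 : V →L[ℝ] V)) := by
  have h : ContDiff ℝ n (NormedSpace.exp : (V →L[ℝ] V) → V →L[ℝ] V) :=
    contDiff_iff_contDiffAt.2 fun A => (NormedSpace.exp_analytic (𝕂 := ℝ) A).contDiffAt
  have h2 : ContDiff ℝ n (fun w : ModelSpace W G => (w.2.2 : V →L[ℝ] V)) :=
    ContinuousLinearMap.contDiff (𝕜 := ℝ) (E := ModelSpace W G) (F := V →L[ℝ] V)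
      ((lieAlg G).subtypeL.comp ((ContinuousLinearMap.snd ℝ W (lieAlg G)).comp
        (ContinuousLinearMap.snd ℝ V (W × lieAlg G))))
  exact h.comp h2

theorem contDiff_phase (hZ : IsAffineHyperplane Z ι) (p : PhaseSpace W G) {n : WithTop ℕ∞} :
    ContDiff ℝ n fun w : ModelSpace W G => phase G R Z (expChart G p w) := by
  simp only [phase_expChart hZ]
  have h1 : ContDiff ℝ n fun w : ModelSpace W G => R w.1 := R.contDiff.comp contDiff_fst
  have h2 : ContDiff ℝ n fun w : ModelSpace W G => ι w.2.1 :=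
    ι.contDiff.comp (contDiff_fst.comp contDiff_snd)
  have h3 : ContDiff ℝ n fun w : ModelSpace W G => p.2.2 • R w.1 :=
    p.2.2.1.1.contDiff.comp h1
  exact ((contDiff_const.add h1).sub (contDiff_expMap.clm_apply (contDiff_const.add h3))).inner ℝ
    (contDiff_const.add h2)

/-- The derivative of the phase function along a line of the exponential chart. -/
theorem hasDerivAt_phase_line (hZ : IsAffineHyperplane Z ι) (p : PhaseSpace W G)
    (w : ModelSpace W G) (t : ℝ) :
    HasDerivAt (fun t : ℝ => phase G R Z (expChart G p (t • w)))
      (⟪(R p.1 + t • R w.1) - NormedSpace.exp (t • (w.2.2 : V →L[ℝ] V))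
          (p.2.2 • R p.1 + t • p.2.2 • R w.1), ι w.2.1⟫ +
        ⟪R w.1 - (NormedSpace.exp (t • (w.2.2 : V →L[ℝ] V))
            ((w.2.2 : V →L[ℝ] V) (p.2.2 • R p.1 + t • p.2.2 • R w.1)) +
          NormedSpace.exp (t • (w.2.2 : V →L[ℝ] V)) (p.2.2 • R w.1)),
          Z p.2.1 + t • ι w.2.1⟫) t := by
  have h := ((hasDerivAt_add_smul (R p.1) (R w.1) t).sub
    (hasDerivAt_exp_smul_line (w.2.2 : V →L[ℝ] V) (p.2.2 • R p.1) (p.2.2 • R w.1) t)).inner ℝ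
    (hasDerivAt_add_smul (Z p.2.1) (ι w.2.1) t)
  refine h.congr_of_eventuallyEq (Eventually.of_forall fun s => ?_)
  change phase G R Z (expChart G p (s • w)) = _
  rw [phase_expChart hZ]
  simp only [Prod.smul_fst, Prod.smul_snd, map_smul, smul_comm p.2.2 s, Submodule.coe_smul]
  rfl

theorem fderiv_phase (hZ : IsAffineHyperplane Z ι) (p : PhaseSpace W G) (w : ModelSpace W G) :
    fderiv ℝ (fun w : ModelSpace W G => phase G R Z (expChart G p w)) 0 w =
      ⟪R p.1 - p.2.2 • R p.1, ι w.2.1⟫ +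
        ⟪R w.1 - ((w.2.2 : V →L[ℝ] V) (p.2.2 • R p.1) + p.2.2 • R w.1), Z p.2.1⟫ := by
  have h1 := hasDerivAt_comp_line ((contDiff_phase (R := R) hZ p (n := 1)).differentiable
    one_ne_zero) w 0
  have h2 := h1.unique (hasDerivAt_phase_line hZ p w 0)
  simpa [zero_smul ℝ (w.2.2 : V →L[ℝ] V), zero_smul ℝ w, NormedSpace.exp_zero] using h2

theorem mem_critSet_phase_iff (hZ : IsAffineHyperplane Z ι) (p : PhaseSpace W G) :
    p ∈ critSet G (phase G R Z) ↔
      p.2.2 • R p.1 = R p.1 ∧ p.2.2 • Z p.2.1 = Z p.2.1 ∧ (R p.1, Z p.2.1) ∈ Omega G := by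
  have h : p ∈ critSet G (phase G R Z) ↔ ∀ w : ModelSpace W G,
      ⟪R p.1 - p.2.2 • R p.1, ι w.2.1⟫ +
        ⟪R w.1 - ((w.2.2 : V →L[ℝ] V) (p.2.2 • R p.1) + p.2.2 • R w.1), Z p.2.1⟫ = 0 := by
    simp only [← fderiv_phase hZ]
    exact ContinuousLinearMap.ext_iff
  rw [h]
  constructor
  · intro hw
    have hZfix : p.2.2 • Z p.2.1 = Z p.2.1 := by
      have h1 : ∀ v : V, ⟪v, Z p.2.1 - p.2.2⁻¹ • Z p.2.1⟫ = 0 := by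
        intro v
        have := hw (R.symm v, 0, 0)
        rw [inner_sub_right, ← inner_smul_eq, ← inner_sub_left]
        simpa using this
      have h2 := sub_eq_zero.1 (inner_self_eq_zero.1 (h1 _))
      exact (eq_inv_smul_iff.1 h2)
    -- The `η'`-derivative tests only the directions of the hyperplane; the missing direction `Z` is
    -- supplied by `k Z = Z`.
    have hXfix : p.2.2 • R p.1 = R p.1 := by
      refine (sub_eq_zero.1 (hZ.eq_zero p.2.1 _ (fun q => ?_) ?_)).symm
      · simpa using hw (0, q, 0)
      · rw [inner_sub_left, inner_smul_left_of_fixed hZfix, sub_self]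
    refine ⟨hXfix, hZfix, fun A hA => ?_⟩
    have := hw (0, 0, ⟨A, hA⟩)
    simpa [hXfix] using this
  · rintro ⟨hX, hZfix, hO⟩ w
    rw [hX, sub_self, inner_zero_left, zero_add, inner_sub_left, inner_add_left,
      inner_smul_left_of_fixed hZfix, hO _ w.2.2.2]
    simp

theorem hess_phase_symm (hZ : IsAffineHyperplane Z ι) (p : PhaseSpace W G)
    (v w : ModelSpace W G) :
    hess G (phase G R Z) p v w = hess G (phase G R Z) p w v :=
  ((contDiff_phase (R := R) hZ p (n := 2)).contDiffAt.isSymmSndFDerivAt (by simp)) v w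

theorem hess_phase_self (hZ : IsAffineHyperplane Z ι) (p : PhaseSpace W G)
    (w : ModelSpace W G) :
    hess G (phase G R Z) p w w =
      2 * ⟪R w.1 - ((w.2.2 : V →L[ℝ] V) (p.2.2 • R p.1) + p.2.2 • R w.1), ι w.2.1⟫ -
        ⟪(w.2.2 : V →L[ℝ] V) ((w.2.2 : V →L[ℝ] V) (p.2.2 • R p.1)), Z p.2.1⟫ -
        2 * ⟪(w.2.2 : V →L[ℝ] V) (p.2.2 • R w.1), Z p.2.1⟫ := by
  set A := (w.2.2 : V →L[ℝ] V)
  have e1 := hasDerivAt_exp_smul_line A (p.2.2 • R p.1) (p.2.2 • R w.1) 0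
  have e2 := hasDerivAt_exp_smul_line A (A (p.2.2 • R p.1)) (A (p.2.2 • R w.1)) 0
  simp only [← map_smul A, ← map_add A] at e2
  have e3 := hasDerivAt_exp_smul_apply A (p.2.2 • R w.1) 0
  have h2 := (((hasDerivAt_add_smul (R p.1) (R w.1) 0).sub e1).inner ℝ
    (hasDerivAt_const (0 : ℝ) (ι w.2.1))).add
    (((hasDerivAt_const (0 : ℝ) (R w.1)).sub (e2.add e3)).inner ℝ
      (hasDerivAt_add_smul (Z p.2.1) (ι w.2.1) 0))
  refine (fderiv_fderiv_apply_self (contDiff_phase hZ p) (hasDerivAt_phase_line hZ p w)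
    (h2.congr_of_eventuallyEq (Eventually.of_forall fun t => ?_))).trans ?_
  · rfl
  simp only [zero_smul, NormedSpace.exp_zero, one_apply_eq_self, add_zero, inner_zero_right,
    zero_add, zero_sub, inner_sub_left, inner_add_left, inner_neg_left, Pi.add_apply,
    Pi.sub_apply]
  ring

/-- The Hessian of the phase function at a critical point. -/
theorem hess_phase (hZ : IsAffineHyperplane Z ι) {p : PhaseSpace W G}
    (hp : p ∈ critSet G (phase G R Z)) (v w : ModelSpace W G) :
    hess G (phase G R Z) p v w =
      ⟪p.2.2 • R w.1, (v.2.2 : V →L[ℝ] V) (Z p.2.1) + p.2.2 • ι v.2.1 - ι v.2.1⟫ -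
        ⟪(v.2.2 : V →L[ℝ] V) (R p.1) + p.2.2 • R v.1 - R v.1, ι w.2.1⟫ -
        (⟪(w.2.2 : V →L[ℝ] V) ((v.2.2 : V →L[ℝ] V) (R p.1) + p.2.2 • R v.1), Z p.2.1⟫ +
          ⟪(w.2.2 : V →L[ℝ] V) (R p.1), ι v.2.1⟫) := by
  obtain ⟨hX, hZfix, hO⟩ := (mem_critSet_phase_iff hZ p).1 hp
  -- Polarization: second derivatives along lines determine the symmetric form.
  have h1 := hess_phase_self (R := R) hZ p (v + w)
  have h0 : hess G (phase G R Z) p (v + w) (v + w) = hess G (phase G R Z) p v v +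
      2 * hess G (phase G R Z) p v w + hess G (phase G R Z) p w w := by
    rw [LinearMap.map_add₂, map_add, map_add, hess_phase_symm hZ p w v]
    ring
  rw [h0, hess_phase_self hZ, hess_phase_self hZ] at h1
  -- The two orders of the `𝔤`-components agree on `Ω₀`, so the symmetrized term reduces to a single
  -- one.
  have h2 := inner_commutator v.2.2.2 w.2.2.2 hO
  have h3 := inner_apply_eq_neg v.2.2.2 (p.2.2 • R w.1) (Z p.2.1)
  have h4 := inner_smul_smul p.2.2 (R w.1) (ι v.2.1)
  simp only [hX, Prod.fst_add, Prod.snd_add, map_add, smul_add, Submodule.coe_add,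
    add_apply, inner_add_left, inner_sub_left, inner_add_right] at h1
  simp only [map_add, inner_add_left, inner_sub_left, inner_add_right, inner_sub_right]
  linarith

/-- The kernel of the Hessian is given by the linearized equations of the critical set. -/
theorem hess_phase_eq_zero_iff (hZ : IsAffineHyperplane Z ι) {p : PhaseSpace W G}
    (hp : p ∈ critSet G (phase G R Z)) (v : ModelSpace W G) :
    (∀ w, hess G (phase G R Z) p v w = 0) ↔
      (v.2.2 : V →L[ℝ] V) (R p.1) + p.2.2 • R v.1 = R v.1 ∧
      (v.2.2 : V →L[ℝ] V) (Z p.2.1) + p.2.2 • ι v.2.1 = ι v.2.1 ∧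
      ∀ A ∈ lieAlg G, ⟪A (R v.1), Z p.2.1⟫ + ⟪A (R p.1), ι v.2.1⟫ = 0 := by
  obtain ⟨hX, hZfix, hO⟩ := (mem_critSet_phase_iff hZ p).1 hp
  simp only [hess_phase hZ hp]
  constructor
  · intro h
    have h2 : (v.2.2 : V →L[ℝ] V) (Z p.2.1) + p.2.2 • ι v.2.1 = ι v.2.1 := by
      refine sub_eq_zero.1 (inner_self_eq_zero (𝕜 := ℝ).1 ?_)
      -- The test vector is chosen so that the Hessian becomes the squared norm of the defect in the
      -- second equation.
      have := h (R.symm (p.2.2⁻¹ • ((v.2.2 : V →L[ℝ] V) (Z p.2.1) + p.2.2 • ι v.2.1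
        - ι v.2.1)), 0, 0)
      simpa using this
    have h1 : (v.2.2 : V →L[ℝ] V) (R p.1) + p.2.2 • R v.1 = R v.1 := by
      refine sub_eq_zero.1 (hZ.eq_zero p.2.1 _ (fun q => ?_) ?_)
      · simpa using h (0, q, 0)
      · rw [inner_sub_left, inner_add_left, inner_smul_left_of_fixed hZfix, hO _ v.2.2.2]
        simp
    refine ⟨h1, h2, fun A hA => ?_⟩
    have := h (0, 0, ⟨A, hA⟩)
    rw [h1] at this
    simp only [map_zero, inner_zero_right, sub_self, inner_zero_left, zero_sub, smul_zero] at this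
    linarith
  · rintro ⟨h1, h2, h3⟩ w
    rw [h1, h2, h3 _ w.2.2.2]
    simp

end Phase

/-! ### The critical set as a submanifold, and its tangent and normal spaces. -/

section CriticalManifold

variable {V W : Type*} [NormedAddCommGroup V] [InnerProductSpace ℝ V] [FiniteDimensional ℝ V]
  [NormedAddCommGroup W] [InnerProductSpace ℝ W] {G : ClosedSubgroup (OrthGroup V)} {κ : ℕ}
  {R : V ≃ₗᵢ[ℝ] V} {Z : W → V} {ι : W →L[ℝ] V}

/-- `frameProj M y` depends linearly on `y`. -/
def frameProjLinear (M : Euc κ →L[ℝ] lieAlg G) : V →L[ℝ] V →L[ℝ] Euc κ :=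
  LinearMap.toContinuousLinearMap
    { toFun := frameProj M
      map_add' := fun y z => by
        refine ContinuousLinearMap.ext fun v => ext_inner_left ℝ fun c => ?_
        simp [inner_frameProj, inner_add_left, inner_add_right]
      map_smul' := fun r y => by
        refine ContinuousLinearMap.ext fun v => ext_inner_left ℝ fun c => ?_
        simp [inner_frameProj, inner_smul_left, inner_smul_right] }

theorem frameProjLinear_apply (M : Euc κ →L[ℝ] lieAlg G) (y : V) :
    frameProjLinear M y = frameProj M y := rfl

/-- The defining equations of the critical set near `p`: the first component is the momentum map
and the second one the tangential part of `k ξ - ξ`. -/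
def critEq (R : V ≃ₗᵢ[ℝ] V) (Z : W → V) (ι : W →L[ℝ] V) (M : Euc κ →L[ℝ] lieAlg G)
    (p : PhaseSpace W G) (w : ModelSpace W G) : Euc κ × Euc κ :=
  (frameProjLinear M (Z p.2.1 + ι w.2.1) (R p.1 + R w.1),
    frameProj M (Z p.2.1) (NormedSpace.exp (w.2.2 : V →L[ℝ] V)
      (p.2.2 • Z p.2.1 + p.2.2 • ι w.2.1) - (Z p.2.1 + ι w.2.1)))

theorem contDiff_critEq (M : Euc κ →L[ℝ] lieAlg G) (p : PhaseSpace W G) {n : WithTop ℕ∞} :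
    ContDiff ℝ n (critEq R Z ι M p) := by
  have h1 : ContDiff ℝ n fun w : ModelSpace W G => R w.1 := R.contDiff.comp contDiff_fst
  have h2 : ContDiff ℝ n fun w : ModelSpace W G => ι w.2.1 :=
    ι.contDiff.comp (contDiff_fst.comp contDiff_snd)
  have h3 : ContDiff ℝ n fun w : ModelSpace W G => p.2.2 • ι w.2.1 :=
    p.2.2.1.1.contDiff.comp h2
  refine ContDiff.prodMk ?_ ?_
  · exact ((frameProjLinear M).contDiff.comp (contDiff_const.add h2)).clm_apply
      (contDiff_const.add h1)
  · exact (frameProj M (Z p.2.1)).contDiff.comp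
      ((contDiff_expMap.clm_apply (contDiff_const.add h3)).sub (contDiff_const.add h2))

theorem fderiv_critEq (M : Euc κ →L[ℝ] lieAlg G) (p : PhaseSpace W G) (v : ModelSpace W G) :
    fderiv ℝ (critEq R Z ι M p) 0 v =
      (frameProj M (ι v.2.1) (R p.1) + frameProj M (Z p.2.1) (R v.1),
        frameProj M (Z p.2.1) ((v.2.2 : V →L[ℝ] V) (p.2.2 • Z p.2.1) + p.2.2 • ι v.2.1
          - ι v.2.1)) := by
  have h1 := hasDerivAt_comp_line ((contDiff_critEq (R := R) (Z := Z) (ι := ι) M p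
    (n := 1)).differentiable one_ne_zero) v 0
  rw [zero_smul] at h1
  have h2 := ((frameProjLinear M).hasFDerivAt.comp_hasDerivAt 0
    (hasDerivAt_add_smul (Z p.2.1) (ι v.2.1) 0)).clm_apply (hasDerivAt_add_smul (R p.1) (R v.1) 0)
  have h3 := (frameProj M (Z p.2.1)).hasFDerivAt.comp_hasDerivAt (0 : ℝ)
    ((hasDerivAt_exp_smul_line (v.2.2 : V →L[ℝ] V) (p.2.2 • Z p.2.1) (p.2.2 • ι v.2.1) 0).sub
      (hasDerivAt_add_smul (Z p.2.1) (ι v.2.1) 0))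
  have h4 := h1.unique ((h2.prodMk h3).congr_of_eventuallyEq
    (Eventually.of_forall fun t => ?_))
  · rw [h4]
    simp only [Function.comp_apply, zero_smul, add_zero, NormedSpace.exp_zero, one_apply_eq_self,
      frameProjLinear_apply]
  · simp only [critEq, Function.comp_apply, Prod.smul_fst, Prod.smul_snd, map_smul,
      smul_comm p.2.2 t, Submodule.coe_smul]
    rfl

theorem critEq_zero {M : Euc κ →L[ℝ] lieAlg G} (hZ : IsAffineHyperplane Z ι) {p : PhaseSpace W G}
    (hp : p ∈ critSet G (phase G R Z)) : critEq R Z ι M p 0 = 0 := by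
  obtain ⟨-, hZfix, hO⟩ := (mem_critSet_phase_iff hZ p).1 hp
  refine Prod.ext ?_ ?_
  · simp only [critEq, Prod.snd_zero, Prod.fst_zero, map_zero, add_zero, frameProjLinear_apply,
      frameProj_eq_zero_iff]
    intro c
    rw [frameMap_apply, inner_apply_eq_neg (M c).2, real_inner_comm, hO _ (M c).2, neg_zero]
  · simp [critEq, hZfix, NormedSpace.exp_zero]

/-- Moving `x` tangentially to the orbit of `Z` fills the first factor, and moving `k` along the
frame fills the second; `η'` stays fixed. -/
theorem surjective_fderiv_critEq {M : Euc κ →L[ℝ] lieAlg G} (hZ : IsAffineHyperplane Z ι)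
    {p : PhaseSpace W G} (hp : p ∈ critSet G (phase G R Z)) (hM : IsOrbitFrame M (Z p.2.1)) :
    Function.Surjective (fderiv ℝ (critEq R Z ι M p) 0) := by
  obtain ⟨-, hZfix, -⟩ := (mem_critSet_phase_iff hZ p).1 hp
  rintro ⟨c, d⟩
  refine ⟨(R.symm (frameMap M (Z p.2.1) c), 0, M d), ?_⟩
  rw [fderiv_critEq]
  simp only [map_zero, smul_zero, add_zero, sub_zero, LinearIsometryEquiv.apply_symm_apply,
    hM.frameProj_frameMap, hZfix]
  rw [← frameMap_apply, hM.frameProj_frameMap, ← frameProjLinear_apply, map_zero]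
  simp

theorem fderiv_critEq_eq_zero (M : Euc κ →L[ℝ] lieAlg G) (hZ : IsAffineHyperplane Z ι)
    {p : PhaseSpace W G} (hp : p ∈ critSet G (phase G R Z)) {v : ModelSpace W G}
    (hv : ∀ w, hess G (phase G R Z) p v w = 0) : fderiv ℝ (critEq R Z ι M p) 0 v = 0 := by
  obtain ⟨-, h2, h3⟩ := (hess_phase_eq_zero_iff hZ hp v).1 hv
  obtain ⟨-, hZfix, -⟩ := (mem_critSet_phase_iff hZ p).1 hp
  rw [fderiv_critEq, hZfix, h2, sub_self, map_zero]
  refine Prod.ext (ext_inner_left ℝ fun c => ?_) rfl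
  have h4 := h3 _ (M c).2
  rw [inner_apply_eq_neg (M c).2, inner_apply_eq_neg (M c).2 (R p.1)] at h4
  simp only [inner_add_right, inner_frameProj, frameMap_apply, Prod.fst_zero, inner_zero_right]
  rw [real_inner_comm, real_inner_comm (R v.1)]
  linarith

/-- In the exponential chart the critical set is locally the zero set of `critEq`. -/
theorem eventually_mem_critSet_iff (hZ : IsAffineHyperplane Z ι) (hreg : ∀ e, Z e ∈ regSet G)
    {M : Euc κ →L[ℝ] lieAlg G} {p : PhaseSpace W G} (hp : p ∈ critSet G (phase G R Z))
    (hM : IsOrbitFrame M (Z p.2.1)) :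
    ∀ᶠ w in 𝓝 (0 : ModelSpace W G),
      expChart G p w ∈ critSet G (phase G R Z) ↔ critEq R Z ι M p w = 0 := by
  obtain ⟨-, hZfix, -⟩ := (mem_critSet_phase_iff hZ p).1 hp
  have hc1 : Continuous fun w : ModelSpace W G => Z p.2.1 + ι w.2.1 :=
    continuous_const.add (ι.continuous.comp (continuous_fst.comp continuous_snd))
  have hc2 : Continuous fun w : ModelSpace W G => NormedSpace.exp (w.2.2 : V →L[ℝ] V)
      (p.2.2 • Z p.2.1 + p.2.2 • ι w.2.1) :=
    (contDiff_expMap (n := 0)).continuous.clm_apply (by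
      simp only [← smul_add]
      exact p.2.2.1.1.continuous.comp hc1)
  have ht1 : Tendsto (fun w : ModelSpace W G => Z p.2.1 + ι w.2.1) (𝓝 0) (𝓝 (Z p.2.1)) := by
    simpa using hc1.tendsto 0
  have ht2 := ht1.prodMk_nhds (hc2.tendsto' 0 (Z p.2.1) (by
    simp [hZfix, NormedSpace.exp_zero]))
  filter_upwards [ht1.eventually (hM.eventually_frame (hreg _)),
    ht2.eventually (hM.eventually_eq_of_frameProj_eq_zero (hreg _))] with w hw1 hw2
  rw [mem_critSet_phase_iff hZ]
  have hx : R (expChart G p w).1 = R p.1 + R w.1 := map_add R _ _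
  have hz : Z (expChart G p w).2.1 = Z p.2.1 + ι w.2.1 := hZ.map_add _ _
  set k := (expChart G p w).2.2 with hk
  have hkz : k • (Z p.2.1 + ι w.2.1) = NormedSpace.exp (w.2.2 : V →L[ℝ] V)
      (p.2.2 • Z p.2.1 + p.2.2 • ι w.2.1) := by
    rw [← smul_add]
    rfl
  have hrz : Z p.2.1 + ι w.2.1 ∈ regSet G := hz ▸ hreg _
  rw [hx, hz, critEq, Prod.mk_eq_zero, ← hkz, frameProjLinear_apply, frameProj_eq_zero_iff]
  constructor
  · rintro ⟨-, h2, h3⟩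
    refine ⟨fun c => ?_, by rw [h2, sub_self, map_zero]⟩
    rw [frameMap_apply, inner_apply_eq_neg (M c).2, real_inner_comm]
    exact neg_eq_zero.2 (h3 _ (M c).2)
  · rintro ⟨h1, h2⟩
    have hnormal : ∀ A ∈ lieAlg G, ⟪A (Z p.2.1 + ι w.2.1), R p.1 + R w.1⟫ = 0 := by
      intro A hA
      -- The frame still spans `𝔤 z` at the displaced covector `z`, so `κ` momentum equations imply
      -- all of them.
      obtain ⟨c, hc⟩ := hw1.1 ⟨A, hA⟩
      have hc' : A (Z p.2.1 + ι w.2.1) = _ := hc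
      rw [hc', h1]
    have h3 : k • (Z p.2.1 + ι w.2.1) = Z p.2.1 + ι w.2.1 := by
      rw [hkz]
      exact hw2 k hkz (by rw [← hkz]; exact h2)
    refine ⟨smul_eq_of_normal hrz hnormal h3, h3, fun A hA => ?_⟩
    rw [inner_apply_eq_neg hA, real_inner_comm]
    exact neg_eq_zero.2 (hnormal A hA)

theorem critSet_phase_eq (hZ : IsAffineHyperplane Z ι) (hreg : ∀ e, Z e ∈ regSet G) :
    critSet G (phase G R Z) = {p | (R p.1, Z p.2.1, p.2.2) ∈ regC G} := by
  ext p
  rw [mem_critSet_phase_iff hZ]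
  constructor
  · rintro ⟨h1, h2, h3⟩
    exact ⟨mem_regOmega h3 (hreg _), Prod.ext h1 h2⟩
  · rintro ⟨h1, h2⟩
    exact ⟨congrArg Prod.fst h2, congrArg Prod.snd h2, h1.1⟩

theorem isSmoothSubmanifold_critSet_phase (hZ : IsAffineHyperplane Z ι)
    (hreg : ∀ e, Z e ∈ regSet G) (hκ : ∀ e, κ = orbitDim G (Z e)) :
    IsSmoothSubmanifold G (critSet G (phase G R Z)) (2 * κ) := by
  intro p hp
  obtain ⟨M, hM⟩ := exists_isOrbitFrame (hκ p.2.1)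
  let e : (Euc κ × Euc κ) ≃L[ℝ] EuclideanSpace ℝ (Fin (2 * κ)) :=
    ContinuousLinearEquiv.ofFinrankEq (by simp [two_mul])
  obtain ⟨U, hU, hUo, h0U⟩ := eventually_nhds_iff.1
    ((eventually_mem_critSet_iff hZ hreg hp hM).and
      (eventually_surjective_fderiv (contDiff_critEq (R := R) (Z := Z) (ι := ι) M p)
        (surjective_fderiv_critEq hZ hp hM)))
  refine ⟨U, fun w => e (critEq R Z ι M p w), hUo, h0U,
    (e.contDiff.comp (contDiff_critEq M p)).contDiffOn, fun w hw => ?_, fun w hw _ => ?_⟩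
  · rw [(hU w hw).1, map_eq_zero_iff e e.injective]
  · have h : fderiv ℝ (fun w => e (critEq R Z ι M p w)) w =
        (e : (Euc κ × Euc κ) →L[ℝ] EuclideanSpace ℝ (Fin (2 * κ))).comp (fderiv ℝ (critEq R Z ι M p) w) :=
      (HasFDerivAt.comp (E := ModelSpace W G) (F := Euc κ × Euc κ) w
        (e : (Euc κ × Euc κ) →L[ℝ] EuclideanSpace ℝ (Fin (2 * κ))).hasFDerivAt
        ((contDiff_critEq M p).differentiable one_ne_zero w).hasFDerivAt).fderiv
    rw [h]
    exact e.surjective.comp (hU w hw).2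

/-- The tangent vectors of the critical set form the kernel of the Hessian. -/
theorem mem_tangentVectors_critSet_phase_iff [FiniteDimensional ℝ W]
    (hZ : IsAffineHyperplane Z ι) (hreg : ∀ e, Z e ∈ regSet G) {p : PhaseSpace W G}
    (hp : p ∈ critSet G (phase G R Z)) (v : ModelSpace W G) :
    v ∈ tangentVectors G (critSet G (phase G R Z)) p ↔
      ∀ w, hess G (phase G R Z) p v w = 0 := by
  constructor
  · rintro ⟨γ, hγ0, hγ, hγS⟩
    have hγ1 : HasDerivAt (fun t => R (γ t).1) (R v.1) 0 := by
      let L : ModelSpace W G →L[ℝ] V := (R.toContinuousLinearEquiv : V →L[ℝ] V).comp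
        (ContinuousLinearMap.fst ℝ V (W × lieAlg G))
      have h := hasDerivAt_clm_comp (E := ModelSpace W G) (F := V) L hγ
      exact h
    have hγ2 : HasDerivAt (fun t => ι (γ t).2.1) (ι v.2.1) 0 := by
      let L : ModelSpace W G →L[ℝ] V := ι.comp ((ContinuousLinearMap.fst ℝ W (lieAlg G)).comp
        (ContinuousLinearMap.snd ℝ V (W × lieAlg G)))
      have h := hasDerivAt_clm_comp (E := ModelSpace W G) (F := V) L hγ
      exact h
    have hγ3 : HasDerivAt (fun t => NormedSpace.exp ((γ t).2.2 : V →L[ℝ] V))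
        (v.2.2 : V →L[ℝ] V) 0 := by
      have h1 : HasDerivAt (fun t => ((γ t).2.2 : V →L[ℝ] V)) (v.2.2 : V →L[ℝ] V) 0 := by
        let L : ModelSpace W G →L[ℝ] V →L[ℝ] V := (lieAlg G).subtypeL.comp
          ((ContinuousLinearMap.snd ℝ W (lieAlg G)).comp
            (ContinuousLinearMap.snd ℝ V (W × lieAlg G)))
        have h := hasDerivAt_clm_comp (E := ModelSpace W G) (F := V →L[ℝ] V) L hγ
        exact h
      have h2 : HasFDerivAt (NormedSpace.exp : (V →L[ℝ] V) → V →L[ℝ] V)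
          (1 : (V →L[ℝ] V) →L[ℝ] (V →L[ℝ] V)) ((γ 0).2.2 : V →L[ℝ] V) := by
        rw [hγ0]
        exact hasFDerivAt_exp_zero
      exact h2.comp_hasDerivAt 0 h1
    have heq := fun t => (mem_critSet_phase_iff hZ _).1 (hγS t)
    have hx : ∀ t, R (expChart G p (γ t)).1 = R p.1 + R (γ t).1 := fun t => map_add R _ _
    have hz : ∀ t, Z (expChart G p (γ t)).2.1 = Z p.2.1 + ι (γ t).2.1 := fun t => hZ.map_add _ _
    simp only [hx, hz] at heq
    obtain ⟨hX, hZfix, -⟩ := (mem_critSet_phase_iff hZ p).1 hp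
    rw [hess_phase_eq_zero_iff hZ hp]
    -- Linearization of `k(t)(x + ρ(t)) = x + ρ(t)`, used for both fixed-point equations.
    have hfix : ∀ (x y : V) (ρ : ℝ → V), p.2.2 • x = x → ρ 0 = 0 → HasDerivAt ρ y 0 →
        (∀ t, (expChart G p (γ t)).2.2 • (x + ρ t) = x + ρ t) →
        (v.2.2 : V →L[ℝ] V) x + p.2.2 • y = y := by
      intro x y ρ hx0 hρ0 hρ hfix
      have h1 : HasDerivAt (fun t => p.2.2 • (x + ρ t)) (p.2.2 • y) 0 :=
        p.2.2.1.1.hasFDerivAt.comp_hasDerivAt 0 (hρ.const_add x)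
      have h2 := hγ3.clm_apply h1
      have h3 := h2.unique ((hρ.const_add x).congr_of_eventuallyEq
        (Eventually.of_forall fun t => by
          exact hfix t))
      simpa [hγ0, hρ0, hx0, NormedSpace.exp_zero] using h3
    refine ⟨hfix _ _ _ hX (by simp [hγ0]) hγ1 fun t => (heq t).1,
      hfix _ _ _ hZfix (by simp [hγ0]) hγ2 fun t => (heq t).2.1, fun A hA => ?_⟩
    have h1 := (A.hasFDerivAt.comp_hasDerivAt 0 (hγ1.const_add (R p.1))).inner ℝ
      (hγ2.const_add (Z p.2.1))
    have h2 := h1.unique ((hasDerivAt_const (0 : ℝ) (0 : ℝ)).congr_of_eventuallyEq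
      (Eventually.of_forall fun t => (heq t).2.2 A hA))
    simp only [Function.comp_apply, hγ0, Prod.fst_zero, Prod.snd_zero, map_zero, add_zero] at h2
    linarith
  · intro hv
    obtain ⟨M, hM⟩ := exists_isOrbitFrame (G := G) (x := Z p.2.1) rfl
    obtain ⟨γ, h0, h1, h2⟩ := exists_curve_of_mem_ker
      ((contDiff_critEq (R := R) (Z := Z) (ι := ι) M p (n := 1)).contDiffAt.hasStrictFDerivAt
        one_ne_zero) (surjective_fderiv_critEq hZ hp hM) (critEq_zero hZ hp)
      (fderiv_critEq_eq_zero M hZ hp hv) (eventually_mem_critSet_iff hZ hreg hp hM)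
    exact ⟨γ, h0, h1, fun t => (h2 t).1.2 (h2 t).2⟩

theorem nondegenerate_hess_phase [FiniteDimensional ℝ W] (hZ : IsAffineHyperplane Z ι)
    (hreg : ∀ e, Z e ∈ regSet G) {p : PhaseSpace W G} (hp : p ∈ critSet G (phase G R Z))
    (b : LinearMap.BilinForm ℝ (ModelSpace W G)) (hb : b.IsSymm)
    (hpos : ∀ v, v ≠ 0 → 0 < b v v) :
    ((hess G (phase G R Z) p).restrict
      (normalSpace G (critSet G (phase G R Z)) p b)).Nondegenerate := by
  refine nondegenerate_restrict_of_orthogonal (hess_phase_symm hZ p) hb hpos fun v => ?_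
  simp only [← mem_tangentVectors_critSet_phase_iff hZ hreg hp]
  rfl

end CriticalManifold

/-! ### The affine hyperplane of the vectors `R₀(η', 1)`. -/

section Hyperplane

variable {m : ℕ}

/-- The inclusion `p ↦ (p, 0)` of `ℝᵐ` into `ℝᵐ⁺¹`. -/
def appendZero : Euc m →L[ℝ] Euc (m + 1) :=
  LinearMap.toContinuousLinearMap
    { toFun := fun e => WithLp.toLp 2 (Fin.snoc (α := fun _ => ℝ) (fun i => e i) 0)
      map_add' := fun e p => by
        ext i
        refine Fin.lastCases ?_ (fun i => ?_) i <;> simp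
      map_smul' := fun r e => by
        ext i
        refine Fin.lastCases ?_ (fun i => ?_) i <;> simp }

@[simp]
theorem appendZero_castSucc (e : Euc m) (i : Fin m) : appendZero e i.castSucc = e i := by
  simp [appendZero]

@[simp]
theorem appendZero_last (e : Euc m) : appendZero e (Fin.last m) = 0 := by
  simp [appendZero]

@[simp]
theorem appendOne_castSucc (e : Euc m) (i : Fin m) : appendOne e i.castSucc = e i := by
  simp [appendOne]

@[simp]
theorem appendOne_last (e : Euc m) : appendOne e (Fin.last m) = 1 := by
  simp [appendOne]

theorem exists_eq_appendZero_add (e : Euc m) (u : Euc (m + 1)) :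
    ∃ p : Euc m, u = appendZero p + u (Fin.last m) • appendOne e := by
  refine ⟨WithLp.toLp 2 fun i => u i.castSucc - u (Fin.last m) * e i, ?_⟩
  ext i
  refine Fin.lastCases ?_ (fun i => ?_) i <;> simp

theorem isAffineHyperplane_appendOne (R : Euc (m + 1) ≃ₗᵢ[ℝ] Euc (m + 1)) :
    IsAffineHyperplane (fun e => R (appendOne e))
      ((R.toContinuousLinearEquiv : Euc (m + 1) →L[ℝ] Euc (m + 1)).comp appendZero) where
  map_add e p := by
    have h : appendOne (e + p) = appendOne e + appendZero p := by
      ext i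
      refine Fin.lastCases ?_ (fun i => ?_) i <;> simp
    rw [h, map_add]
    rfl
  eq_zero e u h1 h2 := by
    obtain ⟨p, hp⟩ := exists_eq_appendZero_add e (R.symm u)
    have h3 : u = R (appendZero p) + (R.symm u) (Fin.last m) • R (appendOne e) := by
      rw [← map_smul, ← map_add, ← hp, R.apply_symm_apply]
    have h4 : ⟪u, R (appendZero p)⟫ = 0 := h1 p
    have h5 : ⟪u, u⟫ = 0 := by
      conv_lhs => arg 3; rw [h3]
      rw [inner_add_right, inner_smul_right, h4, h2]
      simp
    exact inner_self_eq_zero.1 h5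

end Hyperplane

end WeakPhase

end

theorem mainTheorem3 (m r : ℕ)
    -- `G` is a compact subgroup of `O(n)`, where `n = m + 1`
    (G : ClosedSubgroup (WeakPhase.OrthGroup (WeakPhase.Euc (m + 1))))
    -- `x₀` lies on a principal orbit and `κ` is the dimension of the principal orbits
    (x₀ : WeakPhase.Euc (m + 1))
    (hx₀ : x₀ ∈ WeakPhase.regSet G)
    (κ : ℕ) (hκ : κ = WeakPhase.orbitDim G x₀)
    -- the non-principal points lie in a strict subspace `F = R₀ (ℝʳ × {0})`, `r < n = m + 1`
    (hr : r < m + 1) (F : Submodule ℝ (WeakPhase.Euc (m + 1)))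
    (hF : WeakPhase.singSet G ⊆ (F : Set (WeakPhase.Euc (m + 1))))
    (R₀ : WeakPhase.Euc (m + 1) ≃ₗᵢ[ℝ] WeakPhase.Euc (m + 1))
    (hR₀ : R₀ '' (WeakPhase.coordSubspace (m + 1) r : Set (WeakPhase.Euc (m + 1)))
      = (F : Set (WeakPhase.Euc (m + 1)))) :
    WeakPhase.critSet G (WeakPhase.psiWk G R₀)
        = {p | (R₀ p.1, R₀ (WeakPhase.appendOne p.2.1), p.2.2) ∈ WeakPhase.regC G} ∧
    WeakPhase.IsSmoothSubmanifold G (WeakPhase.critSet G (WeakPhase.psiWk G R₀)) (2 * κ) ∧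
    -- on the normal space with respect to an arbitrary Riemannian metric the Hessian is
    -- nondegenerate
    ∀ p ∈ WeakPhase.critSet G (WeakPhase.psiWk G R₀),
      ∀ b : LinearMap.BilinForm ℝ (WeakPhase.ModelSpace (WeakPhase.Euc m) G),
        b.IsSymm → (∀ v, v ≠ 0 → 0 < b v v) →
        ((WeakPhase.hess G (WeakPhase.psiWk G R₀) p).restrict
          (WeakPhase.normalSpace G (WeakPhase.critSet G (WeakPhase.psiWk G R₀)) p b)).Nondegenerate
    := by
  have hpsi : WeakPhase.psiWk G R₀ =
      WeakPhase.phase G R₀ (fun e => R₀ (WeakPhase.appendOne e)) := rfl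
  have hZ := WeakPhase.isAffineHyperplane_appendOne R₀
  have hreg : ∀ e : WeakPhase.Euc m, R₀ (WeakPhase.appendOne e) ∈ WeakPhase.regSet G := by
    intro e
    by_contra hsing
    have hmem : R₀ (WeakPhase.appendOne e) ∈ (F : Set (WeakPhase.Euc (m + 1))) := hF hsing
    rw [← hR₀] at hmem
    obtain ⟨y, hy, hye⟩ := hmem
    -- As `r ≤ m`, the last coordinate (index `m`) vanishes on `ℝʳ × {0}`, but it is `1` for `(η',
    -- 1)`.
    have h1 := hy (Fin.last m) (Nat.lt_succ_iff.1 hr)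
    rw [R₀.injective hye, WeakPhase.appendOne_last] at h1
    exact one_ne_zero h1
  rw [hpsi]
  exact ⟨WeakPhase.critSet_phase_eq hZ hreg,
    WeakPhase.isSmoothSubmanifold_critSet_phase hZ hreg fun e => hκ.trans
      (WeakPhase.orbitDim_eq_of_mem_regSet hx₀ (hreg e)),
    fun p hp b hb hpos => WeakPhase.nondegenerate_hess_phase hZ hreg hp b hb hpos⟩
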